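/- **Setting.** Let $\mathcal X,\mathcal Y$ be measurable spaces and $\mathcal T\subseteq\mathbb R^k$ a set of domain indices. Let $\nu$ be a probability distribution on samples $z=(x,y,t)\in\mathcal X\times\mathcal Y\times\mathcal T$. Let $w,\Phi,h,g$ be a classifier, a featurizer and two domain-index regressors that are parametrized by finite-dimensional Euclidean vectors (denoted by the same letters). Let $\ell$ be a prediction loss and $\lambda>0$. Write $\theta=(w,\Phi,h)$, with the Euclidean norm, and $$q(\theta,g;z)=\ell\big(w(\Phi(x)),y\big)+\lambda\big(\|h(\Phi(x))-t\|_2^2-\|g(\Phi(x),y)-t\|_2^2\big).$$ Let $\Theta$ and $\mathcal G$ be closed convex sets of parameters $\theta$ and $g$. Let $Q(\theta,g)=\mathbb E_{z\sim\nu}\,q(\theta,g;z)$ and $Q^*(\theta)=\sup_{g\in\mathcal G}Q(\theta,g)$. For a training set $S=(z_1,\dots,z_n)$, $n\ge1$, let $\hat Q_S(\theta,g)=\frac1n\sum_{i=1}^n q(\theta,g;z_i)$. **Assumptions.** Let $\mu,L,\beta>0$. 1. For all $\theta\in\Theta$, $g\in\mathcal G$, the loss $q(\theta,g;\cdot)$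 is measurable and $0\le q(\theta,g;z)\le M$ for all $z$. 2. $Q(\cdot,g)$ is $\mu$-strongly convex on $\Theta$ for every $g\in\mathcal G$, and $Q(\theta,\cdot)$ is $\mu$-strongly concave on $\mathcal G$ for every $\theta\in\Theta$. 3. For all $\theta\in\Theta$, $g\in\mathcal G$ and all $z$, the partial gradients of $q$ exist and satisfy $\|\nabla_\theta q(\theta,g;z)\|\le L$ and $\|\nabla_g q(\theta,g;z)\|\le L$. 4. For every $z$, the map $(\theta,g)\mapsto(\nabla_\theta q(\theta,g;z),\nabla_g q(\theta,g;z))$ is $\beta$-Lipschitz on $\Theta\times\mathcal G$ for the Euclidean norms. 5. $A$ is a measurable, possibly randomized, training algorithm (for instance stochastic gradient descent ascent, SGDA) that maps an internal random seed $\omega$ and a training set $S$ to $(\hat\theta,\hat g)\in\Theta\times\mathcal G$. It is $\varepsilon$-argument-stable: for almost every seed, for every training set of size $n$, replacing one of its points by any other sample moves $\hat\theta$ by at most $\varepsilon$ and $\hat g$ by at most $\varepsilon$ in norm. 6. Let $S\sim\nu^n$ be independent of the seed. Almost surely, the output is an $(\varepsilon_1,\varepsilon_2)$-approximate saddle point of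 the empirical objective: $$\hat Q_S(\hat\theta,\hat g)\le\inf_{\theta\in\Theta}\hat Q_S(\theta,\hat g)+\varepsilon_1,\qquad \hat Q_S(\hat\theta,\hat g)\ge\sup_{g\in\mathcal G}\hat Q_S(\hat\theta,g)-\varepsilon_2.$$ **Claim.** There is an absolute constant $C>0$ such that in every such setting, for every $\eta>0$ and every $0<\delta\le\frac12$, with probability at least $1-\delta$ over the training set and the seed, $$Q^*(\hat\theta)\le(1+\eta)\inf_{\theta\in\Theta}Q^*(\theta)+C\,\frac{1+\eta}{\eta}\left(\frac Mn\log\frac1\delta+\Big(\frac\beta\mu+1\Big)L\,\varepsilon\,\log_2 n\,\log\frac1\delta+\varepsilon_1+\varepsilon_2\right).$$ -/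

import Mathlib

open MeasureTheory

noncomputable section

/-- Parameters `θ = (w, Φ, h)` of the minimizing player, with the Euclidean norm of the
concatenated vector. -/
abbrev PrimalParam (a b c : ℕ) : Type :=
  WithLp 2 (EuclideanSpace ℝ (Fin a) × WithLp 2 (EuclideanSpace ℝ (Fin b) × EuclideanSpace ℝ (Fin c)))

/-- Parameters `g` of the maximizing player. -/
abbrev DualParam (d : ℕ) : Type := EuclideanSpace ℝ (Fin d)

/-- A sample `(x, y, t)`; the domain index `t` ranges over a subset `T` of `ℝᵏ`. -/
abbrev Sample (X Y : Type*) {k : ℕ} (T : Set (EuclideanSpace ℝ (Fin k))) : Type _ :=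
  X × Y × T

/-- A parametric model for continuous invariance learning. The inputs lie in `X`, the labels in `Y`,
the features in `R`, the predictions in `O`, and the domain indices in `ℝᵏ`. -/
structure CILModel (X Y R O : Type*) (k a b c d : ℕ) where
  /-- the classifiers `w` -/
  clf : EuclideanSpace ℝ (Fin a) → R → O
  /-- the featurizers `Φ` -/
  feat : EuclideanSpace ℝ (Fin b) → X → R
  /-- the domain index regressors `h`, which see the features only -/
  regH : EuclideanSpace ℝ (Fin c) → R → EuclideanSpace ℝ (Fin k)
  /-- the domain index regressors `g`, which see the features and the label -/
  regG : DualParam d → R → Y → EuclideanSpace ℝ (Fin k)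
  /-- the prediction loss `ℓ` -/
  loss : O → Y → ℝ
  /-- the penalty weight `λ` -/
  lam : ℝ
  lam_pos : 0 < lam

namespace CILModel

variable {X Y R O : Type*} {k a b c d : ℕ} {T : Set (EuclideanSpace ℝ (Fin k))}

/-- The loss on a single sample,
`q(θ, g; z) = ℓ(w(Φ(x)), y) + λ (‖h(Φ(x)) - t‖² - ‖g(Φ(x), y) - t‖²)`. -/
def q (m : CILModel X Y R O k a b c d) (θ : PrimalParam a b c) (g : DualParam d)
    (z : Sample X Y T) : ℝ :=
  m.loss (m.clf θ.fst (m.feat θ.snd.fst z.1)) z.2.1 +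
    m.lam * (‖m.regH θ.snd.snd (m.feat θ.snd.fst z.1) - (z.2.2 : EuclideanSpace ℝ (Fin k))‖ ^ 2 -
      ‖m.regG g (m.feat θ.snd.fst z.1) z.2.1 - (z.2.2 : EuclideanSpace ℝ (Fin k))‖ ^ 2)

/-- The population objective `Q(θ, g) = 𝔼 q(θ, g; z)`. -/
def risk [MeasurableSpace X] [MeasurableSpace Y] (m : CILModel X Y R O k a b c d)
    (ν : Measure (Sample X Y T)) (θ : PrimalParam a b c) (g : DualParam d) : ℝ :=
  ∫ z, m.q θ g z ∂ν

/-- The empirical objective: the mean of `q(θ, g; ·)` over the training set `S`. -/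
def empRisk {n : ℕ} (m : CILModel X Y R O k a b c d) (S : Fin n → Sample X Y T)
    (θ : PrimalParam a b c) (g : DualParam d) : ℝ :=
  (1 / (n : ℝ)) * ∑ i, m.q θ g (S i)

/-- `Q*(θ) = sup_{g ∈ G} Q(θ, g)`. -/
def primalRisk [MeasurableSpace X] [MeasurableSpace Y] (m : CILModel X Y R O k a b c d)
    (ν : Measure (Sample X Y T)) (G : Set (DualParam d)) (θ : PrimalParam a b c) : ℝ :=
  ⨆ g : G, m.risk ν θ g

/-- `(θ₀, g₀)` is an `(ε₁, ε₂)`-approximate saddle point of the empirical objective over `Θ × G`. -/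
structure IsApproxSaddle {n : ℕ} (m : CILModel X Y R O k a b c d)
    (Θ : Set (PrimalParam a b c)) (G : Set (DualParam d)) (S : Fin n → Sample X Y T)
    (ε₁ ε₂ : ℝ) (θ₀ : PrimalParam a b c) (g₀ : DualParam d) : Prop where
  mem_primal : θ₀ ∈ Θ
  mem_dual : g₀ ∈ G
  le_inf : m.empRisk S θ₀ g₀ ≤ (⨅ θ : Θ, m.empRisk S θ g₀) + ε₁
  sup_le : (⨆ g : G, m.empRisk S θ₀ g) - ε₂ ≤ m.empRisk S θ₀ g₀

/-- On `Θ × G`, the loss `q(·, ·; z)` has partial gradients in `θ` and in `g`, for every sample `z`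
whose domain index lies in `T`. -/
def IsDifferentiable (m : CILModel X Y R O k a b c d) (T : Set (EuclideanSpace ℝ (Fin k)))
    (Θ : Set (PrimalParam a b c)) (G : Set (DualParam d)) : Prop :=
  ∀ θ ∈ Θ, ∀ g ∈ G, ∀ z : Sample X Y T,
    DifferentiableAt ℝ (fun θ' => m.q θ' g z) θ ∧ DifferentiableAt ℝ (fun g' => m.q θ g' z) g

/-- The partial gradient `∇_θ q(θ, g; z)`. -/
def gradPrimal (m : CILModel X Y R O k a b c d) (θ : PrimalParam a b c) (g : DualParam d)
    (z : Sample X Y T) : PrimalParam a b c :=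
  gradient (fun θ' => m.q θ' g z) θ

/-- The partial gradient `∇_g q(θ, g; z)`. -/
def gradDual (m : CILModel X Y R O k a b c d) (θ : PrimalParam a b c) (g : DualParam d)
    (z : Sample X Y T) : DualParam d :=
  gradient (fun g' => m.q θ g' z) g

/-- Lipschitz continuity: both partial gradients are bounded by `L`. -/
def HasBoundedGradient (m : CILModel X Y R O k a b c d) (T : Set (EuclideanSpace ℝ (Fin k)))
    (Θ : Set (PrimalParam a b c)) (G : Set (DualParam d)) (L : ℝ) : Prop :=
  ∀ θ ∈ Θ, ∀ g ∈ G, ∀ z : Sample X Y T, ‖m.gradPrimal θ g z‖ ≤ L ∧ ‖m.gradDual θ g z‖ ≤ L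

/-- Smoothness: the stacked gradient `(∇_θ q, ∇_g q)` is `β`-Lipschitz in `(θ, g)` for the Euclidean
norms. -/
def IsSmooth (m : CILModel X Y R O k a b c d) (T : Set (EuclideanSpace ℝ (Fin k)))
    (Θ : Set (PrimalParam a b c)) (G : Set (DualParam d)) (β : ℝ) : Prop :=
  ∀ θ₁ ∈ Θ, ∀ θ₂ ∈ Θ, ∀ g₁ ∈ G, ∀ g₂ ∈ G, ∀ z : Sample X Y T,
    ‖WithLp.toLp 2 (m.gradPrimal θ₁ g₁ z - m.gradPrimal θ₂ g₂ z,
        m.gradDual θ₁ g₁ z - m.gradDual θ₂ g₂ z)‖ ≤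
      β * ‖WithLp.toLp 2 (θ₁ - θ₂, g₁ - g₂)‖

end CILModel

/-- `ε`-argument-stability of a training procedure: replacing one point of the training set moves
each of the two outputs by at most `ε`. -/
def ArgumentStable {Z : Type*} {n a b c d : ℕ}
    (A : (Fin n → Z) → PrimalParam a b c × DualParam d) (ε : ℝ) : Prop :=
  ∀ (S : Fin n → Z) (i : Fin n) (z : Z),
    ‖(A (Function.update S i z)).1 - (A S).1‖ ≤ ε ∧ ‖(A (Function.update S i z)).2 - (A S).2‖ ≤ ε

end

/-! Let `gs θ` be a maximizer of `Q(θ, ·)` over `G`, let `θ₀` be a competitor, and fix the seed. The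
approximate saddle property, tested at the pair `θ₀`, `gs θ̂`, says that the training loss of `f₁(S,
z) = q(θ̂, gs θ̂; z)` is at most that of `f₂(S, z) = q(θ₀, ĝ; z)` plus `ε₁ + ε₂`. The population
loss of `f₁` is `Q*(θ̂)`, that of `f₂` is at most `Q*(θ₀)`. It remains to pass between training and
population losses, upwards for `f₁` and downwards for `f₂`.

Both losses are stable. Strong concavity and smoothness make `gs` Lipschitz with constant `2β/μ`
(`norm_bestResponse_sub_le`), so replacing one sample moves `f₁` by at most `(2β/μ + 1) L ε` and
`f₂` by at most `L ε`.

For a `γ`-stable loss with values in `[0, M]`, the gap at the `i`-th sample is within `2γ` of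
`resampledGap`, which is centered in the coordinate `i` and has bounded differences `2γ` in the
others. Write it as its conditional mean given `S i` plus a remainder. The remainders sum to order
`γ n log n log(1/δ)`, by dyadic splitting of the index set (`integral_exp_sum_sub_coordAvg_le_two`).
The conditional means are i.i.d. terms `V - v (S i)` with `0 ≤ v ≤ M` and mean `V` of `v`. Since `v²
≤ M v`, their variance is at most `M V`, and Chernoff's bound (`measure_chernoff_le`) costs `τ n V +
(M/τ) log(1/δ)`, with no `√n` term.

The saddle property in expectation bounds `V` for both losses by about `Q*(θ₀)`, so the terms `τ V`
are absorbed into the factor `1 + η` once `τ` is of order `η / (1 + η)`. -/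

set_option linter.unusedSectionVars false

/-! ### Bounded measurable functions: closure properties that settle integrability throughout. -/

section BoundedMeasurable

/-- A bounded measurable real function. -/
structure BddMeasurable {α : Type*} [MeasurableSpace α] (f : α → ℝ) : Prop where
  measurable : Measurable f
  bounded : ∃ C, ∀ x, |f x| ≤ C

namespace BddMeasurable

variable {α β : Type*} [MeasurableSpace α] [MeasurableSpace β] {f g : α → ℝ}

theorem of_mem_Icc {a b : ℝ} (hf : Measurable f) (h : ∀ x, a ≤ f x ∧ f x ≤ b) :
    BddMeasurable f :=
  ⟨hf, max |a| |b|, fun x => abs_le_max_abs_abs (h x).1 (h x).2⟩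

theorem const (c : ℝ) : BddMeasurable (fun _ : α => c) := ⟨measurable_const, |c|, fun _ => le_rfl⟩

theorem add (hf : BddMeasurable f) (hg : BddMeasurable g) :
    BddMeasurable (fun x => f x + g x) := by
  obtain ⟨C, hC⟩ := hf.bounded
  obtain ⟨D, hD⟩ := hg.bounded
  exact ⟨hf.measurable.add hg.measurable, C + D,
    fun x => (abs_add_le _ _).trans (add_le_add (hC x) (hD x))⟩

theorem mul (hf : BddMeasurable f) (hg : BddMeasurable g) :
    BddMeasurable (fun x => f x * g x) := by
  obtain ⟨C, hC⟩ := hf.bounded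
  obtain ⟨D, hD⟩ := hg.bounded
  refine ⟨hf.measurable.mul hg.measurable, C * D, fun x => ?_⟩
  rw [abs_mul]
  exact mul_le_mul (hC x) (hD x) (abs_nonneg _) ((abs_nonneg _).trans (hC x))

theorem const_mul (hf : BddMeasurable f) (c : ℝ) : BddMeasurable (fun x => c * f x) :=
  (const c).mul hf

theorem div_const (hf : BddMeasurable f) (c : ℝ) : BddMeasurable (fun x => f x / c) := by
  simpa only [div_eq_inv_mul] using hf.const_mul c⁻¹

theorem neg (hf : BddMeasurable f) : BddMeasurable (fun x => -f x) := by
  simpa using hf.const_mul (-1)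

theorem sub (hf : BddMeasurable f) (hg : BddMeasurable g) :
    BddMeasurable (fun x => f x - g x) := by
  simpa only [sub_eq_add_neg] using hf.add hg.neg

theorem sq (hf : BddMeasurable f) : BddMeasurable (fun x => f x ^ 2) := by
  simpa only [pow_two] using hf.mul hf

theorem exp (hf : BddMeasurable f) : BddMeasurable (fun x => Real.exp (f x)) := by
  obtain ⟨C, hC⟩ := hf.bounded
  refine ⟨hf.measurable.exp, Real.exp C, fun x => ?_⟩
  rw [abs_of_pos (Real.exp_pos _)]
  exact Real.exp_le_exp.2 (abs_le.1 (hC x)).2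

theorem sum {κ : Type*} (s : Finset κ) {f : κ → α → ℝ} (h : ∀ i ∈ s, BddMeasurable (f i)) :
    BddMeasurable (fun x => ∑ i ∈ s, f i x) := by
  classical
  induction s using Finset.induction_on with
  | empty => simpa using const (α := α) 0
  | insert i s hi ih =>
    simp only [Finset.sum_insert hi]
    exact (h i (by simp)).add (ih fun j hj => h j (by simp [hj]))

theorem comp (hf : BddMeasurable f) {φ : β → α} (hφ : Measurable φ) :
    BddMeasurable (fun x => f (φ x)) :=
  ⟨hf.measurable.comp hφ, hf.bounded.imp fun _ h x => h (φ x)⟩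

theorem integrable (hf : BddMeasurable f) (μ : Measure α) [IsFiniteMeasure μ] :
    Integrable f μ := by
  obtain ⟨C, hC⟩ := hf.bounded
  exact Integrable.of_bound hf.measurable.aestronglyMeasurable C (Filter.Eventually.of_forall hC)

theorem integral_prod_right {F : α × β → ℝ} (hF : BddMeasurable F) (μ : Measure β)
    [IsProbabilityMeasure μ] : BddMeasurable (fun x => ∫ y, F (x, y) ∂μ) := by
  obtain ⟨C, hC⟩ := hF.bounded
  refine ⟨hF.measurable.stronglyMeasurable.integral_prod_right'.measurable, C, fun x => ?_⟩
  have := norm_integral_le_of_norm_le_const (μ := μ) (f := fun y => F (x, y)) (C := C)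
    (Filter.Eventually.of_forall fun y => hC (x, y))
  simpa using this

end BddMeasurable

end BoundedMeasurable

/-! ### Averages over coordinates: pointwise versions of conditional expectations under a product
measure. -/

section CoordinateAverage

variable {ι Z : Type*} [Fintype ι] [DecidableEq ι] [MeasurableSpace Z]

theorem measurable_finset_piecewise (B : Finset ι) :
    Measurable (fun p : (ι → Z) × (ι → Z) => B.piecewise p.1 p.2) := by
  refine measurable_pi_lambda _ fun i => ?_
  by_cases h : i ∈ B
  · simpa [h] using (measurable_pi_apply i).fun_comp measurable_fst
  · simpa [h] using (measurable_pi_apply i).fun_comp measurable_snd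

variable (ν : Measure Z) [IsProbabilityMeasure ν]

/-- Splicing two independent samples along `B` gives again a sample with the product law. The tower
property and the invariance of the integral under `coordAvg` rest on this. -/
theorem measurePreserving_finset_piecewise (B : Finset ι) :
    MeasurePreserving (fun p : (ι → Z) × (ι → Z) => B.piecewise p.1 p.2)
      ((Measure.pi fun _ => ν).prod (Measure.pi fun _ => ν)) (Measure.pi fun _ => ν) := by
  refine ⟨measurable_finset_piecewise B, ?_⟩
  refine (Measure.pi_eq fun s hs => ?_).symm
  rw [Measure.map_apply (measurable_finset_piecewise B) (MeasurableSet.univ_pi hs)]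
  have : (fun p : (ι → Z) × (ι → Z) => B.piecewise p.1 p.2) ⁻¹' Set.univ.pi s =
      (Set.univ.pi fun i => if i ∈ B then s i else Set.univ) ×ˢ
        (Set.univ.pi fun i => if i ∈ B then Set.univ else s i) := by
    ext p
    simp only [Set.mem_preimage, Set.mem_pi, Set.mem_univ, true_imp_iff, Set.mem_prod,
      ← forall_and]
    refine forall_congr' fun i => ?_
    by_cases h : i ∈ B <;> simp [h]
  rw [this, Measure.prod_prod, Measure.pi_pi, Measure.pi_pi, ← Finset.prod_mul_distrib]
  refine Finset.prod_congr rfl fun i _ => ?_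
  by_cases h : i ∈ B <;> simp [h]

/-- The average of `f` over the coordinates in `B`. -/
noncomputable def coordAvg (B : Finset ι) (f : (ι → Z) → ℝ) (S : ι → Z) : ℝ :=
  ∫ S', f (B.piecewise S' S) ∂(Measure.pi fun _ => ν)

variable {ν}

theorem integral_integral_piecewise (B : Finset ι) {f : (ι → Z) → ℝ} (hf : BddMeasurable f) :
    ∫ S, ∫ S', f (B.piecewise S' S) ∂(Measure.pi fun _ => ν) ∂(Measure.pi fun _ => ν) =
      ∫ S, f S ∂(Measure.pi fun _ => ν) := by
  have hmp := measurePreserving_finset_piecewise ν B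
  conv_rhs => rw [← hmp.map_eq]
  rw [integral_map hmp.measurable.aemeasurable hf.measurable.aestronglyMeasurable,
    integral_prod_symm _ ((hf.comp hmp.measurable).integrable _)]

theorem BddMeasurable.coordAvg {f : (ι → Z) → ℝ} (hf : BddMeasurable f) (B : Finset ι) :
    BddMeasurable (coordAvg ν B f) :=
  BddMeasurable.integral_prod_right (F := fun p : (ι → Z) × (ι → Z) => f (B.piecewise p.2 p.1))
    (hf.comp ((measurable_finset_piecewise B).comp measurable_swap)) _

theorem integral_coordAvg (B : Finset ι) {f : (ι → Z) → ℝ} (hf : BddMeasurable f) :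
    ∫ S, coordAvg ν B f S ∂(Measure.pi fun _ => ν) = ∫ S, f S ∂(Measure.pi fun _ => ν) :=
  integral_integral_piecewise B hf

theorem coordAvg_coordAvg (B C : Finset ι) {f : (ι → Z) → ℝ} (hf : BddMeasurable f) :
    coordAvg ν B (coordAvg ν C f) = coordAvg ν (B ∪ C) f := by
  ext S
  have h : ∀ S₁ S₂ : ι → Z, C.piecewise S₂ (B.piecewise S₁ S) =
      (B ∪ C).piecewise (C.piecewise S₂ S₁) S := by
    intro S₁ S₂
    ext i
    by_cases h₁ : i ∈ B <;> by_cases h₂ : i ∈ C <;> simp [h₁, h₂]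
  simp only [coordAvg, h]
  exact integral_integral_piecewise C (f := fun S' => f ((B ∪ C).piecewise S' S))
    (hf.comp ((measurable_finset_piecewise (B ∪ C)).comp (measurable_id.prodMk measurable_const)))

theorem coordAvg_empty (f : (ι → Z) → ℝ) : coordAvg ν ∅ f = f := by
  ext S; simp [coordAvg]

theorem BddMeasurable.comp_piecewise {f : (ι → Z) → ℝ} (hf : BddMeasurable f) (B : Finset ι)
    (S : ι → Z) : BddMeasurable (fun S' => f (B.piecewise S' S)) :=
  hf.comp ((measurable_finset_piecewise B).comp (measurable_id.prodMk measurable_const))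

theorem coordAvg_sub (B : Finset ι) {f g : (ι → Z) → ℝ} (hf : BddMeasurable f)
    (hg : BddMeasurable g) (S : ι → Z) :
    coordAvg ν B (fun S => f S - g S) S = coordAvg ν B f S - coordAvg ν B g S :=
  integral_sub ((hf.comp_piecewise B S).integrable _) ((hg.comp_piecewise B S).integrable _)

theorem coordAvg_zero (B : Finset ι) : coordAvg ν B (fun _ : ι → Z => (0 : ℝ)) = fun _ => 0 := by
  ext S; simp [coordAvg]

theorem piecewise_update_of_mem {B : Finset ι} {i : ι} (hi : i ∈ B) (S' S : ι → Z) (z : Z) :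
    B.piecewise S' (Function.update S i z) = B.piecewise S' S := by
  ext j
  by_cases hj : j ∈ B
  · simp [hj]
  · have : j ≠ i := fun h => hj (h ▸ hi)
    simp [hj, this]

/-- `f` does not depend on the coordinate `i`. -/
def IndepOfCoord (i : ι) (f : (ι → Z) → ℝ) : Prop := ∀ S z, f (Function.update S i z) = f S

theorem indepOfCoord_coordAvg_of_mem {B : Finset ι} {i : ι} (hi : i ∈ B) (f : (ι → Z) → ℝ) :
    IndepOfCoord i (coordAvg ν B f) := by
  intro S z
  simp only [coordAvg, piecewise_update_of_mem hi]

/-- Orthogonality of martingale differences: averaging over the coordinate `i` first, the weight `W`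
comes out as a constant. -/
theorem integral_mul_eq_zero_of_coordAvg {i : ι} {W D : (ι → Z) → ℝ} (hW : BddMeasurable W)
    (hD : BddMeasurable D) (hi : IndepOfCoord i W) (h0 : ∀ S, coordAvg ν {i} D S = 0) :
    ∫ S, W S * D S ∂(Measure.pi fun _ => ν) = 0 := by
  rw [← integral_coordAvg {i} (hW.mul hD)]
  have : ∀ S, coordAvg ν {i} (fun S => W S * D S) S = 0 := by
    intro S
    have : ∀ S', W (({i} : Finset ι).piecewise S' S) = W S := fun S' => by
      rw [Finset.piecewise_singleton]; exact hi _ _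
    simp only [coordAvg, this]
    rw [integral_const_mul]
    have := h0 S
    simp only [coordAvg] at this
    rw [this, mul_zero]
  simp [this]

/-- Changing one coordinate in `B` changes `f` by at most `β`. -/
def BoundedDiff (B : Finset ι) (β : ℝ) (f : (ι → Z) → ℝ) : Prop :=
  ∀ j ∈ B, ∀ S z, |f (Function.update S j z) - f S| ≤ β

theorem BoundedDiff.mono {B C : Finset ι} {β : ℝ} {f : (ι → Z) → ℝ} (h : BoundedDiff C β f)
    (hBC : B ⊆ C) : BoundedDiff B β f := fun j hj => h j (hBC hj)

theorem abs_integral_le_of_abs_le {α : Type*} [MeasurableSpace α] {μ : Measure α}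
    [IsProbabilityMeasure μ] {f : α → ℝ} {C : ℝ} (h : ∀ x, |f x| ≤ C) : |∫ x, f x ∂μ| ≤ C := by
  simpa using norm_integral_le_of_norm_le_const (μ := μ) (f := f) (Filter.Eventually.of_forall h)

theorem BoundedDiff.coordAvg {C : Finset ι} {β : ℝ} (hβ : 0 ≤ β) {f : (ι → Z) → ℝ}
    (hf : BddMeasurable f) (h : BoundedDiff C β f) (B : Finset ι) :
    BoundedDiff C β (coordAvg ν B f) := by
  intro j hj S z
  by_cases hB : j ∈ B
  · rw [indepOfCoord_coordAvg_of_mem hB, sub_self, abs_zero]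
    exact hβ
  · simp only [_root_.coordAvg]
    rw [← integral_sub ((hf.comp_piecewise B _).integrable _) ((hf.comp_piecewise B _).integrable _)]
    refine abs_integral_le_of_abs_le fun S' => ?_
    rw [← Finset.update_piecewise_of_notMem _ _ _ hB]
    exact h j hj _ _

theorem BoundedDiff.abs_sub_coordAvg_le {i : ι} {β : ℝ} {f : (ι → Z) → ℝ}
    (hf : BddMeasurable f) (h : BoundedDiff {i} β f) (S : ι → Z) :
    |f S - _root_.coordAvg ν {i} f S| ≤ β := by
  have : f S - _root_.coordAvg ν {i} f S =
      ∫ S', (f S - f (({i} : Finset ι).piecewise S' S)) ∂(Measure.pi fun _ => ν) := by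
    rw [integral_sub (integrable_const _) ((hf.comp_piecewise _ _).integrable _)]
    simp [_root_.coordAvg]
  rw [this]
  refine abs_integral_le_of_abs_le fun S' => ?_
  rw [Finset.piecewise_singleton, abs_sub_comm]
  exact h i (by simp) _ _

end CoordinateAverage

/-! ### Exponential moments of sums of weakly dependent terms. -/

section Concentration

/-- The linear term vanishes when integrated over a centered variable, so `exp D` may be replaced by
`exp (D ^ 2)` under the integral. -/
theorem exp_le_add_exp_sq (x : ℝ) : Real.exp x ≤ x + Real.exp (x ^ 2) := by
  have h2 : x ^ 2 + 1 ≤ Real.exp (x ^ 2) := Real.add_one_le_exp _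
  rcases le_or_gt |x| 1 with h | h
  · have := (abs_le.1 (Real.abs_exp_sub_one_sub_id_le h)).2
    linarith
  · rcases lt_abs.1 h with h | h
    · have : Real.exp x ≤ Real.exp (x ^ 2) := Real.exp_le_exp.2 (by nlinarith)
      linarith
    · have : Real.exp x ≤ 1 := Real.exp_le_one_iff.2 (by linarith)
      nlinarith

variable {ι Z : Type*} [Fintype ι] [DecidableEq ι] [MeasurableSpace Z]
variable {ν : Measure Z} [IsProbabilityMeasure ν]

theorem integral_mul_exp_le_integral_mul_exp_sq {i : ι} {W D : (ι → Z) → ℝ}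
    (hW : BddMeasurable W) (hW0 : ∀ S, 0 ≤ W S) (hD : BddMeasurable D) (hi : IndepOfCoord i W)
    (h0 : ∀ S, coordAvg ν {i} D S = 0) :
    ∫ S, W S * Real.exp (D S) ∂(Measure.pi fun _ => ν) ≤
      ∫ S, W S * Real.exp (D S ^ 2) ∂(Measure.pi fun _ => ν) := by
  have h1 : ∫ S, W S * Real.exp (D S) ∂(Measure.pi fun _ => ν) ≤
      ∫ S, (W S * D S + W S * Real.exp (D S ^ 2)) ∂(Measure.pi fun _ => ν) := by
    refine integral_mono ((hW.mul hD.exp).integrable _)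
      (((hW.mul hD).add (hW.mul hD.sq.exp)).integrable _) fun S => ?_
    simp only [← mul_add]
    exact mul_le_mul_of_nonneg_left (exp_le_add_exp_sq _) (hW0 S)
  rw [integral_add ((hW.mul hD).integrable _) ((hW.mul hD.sq.exp).integrable _),
    integral_mul_eq_zero_of_coordAvg hW hD hi h0, zero_add] at h1
  exact h1

/-- With the coordinates outside `B` frozen, the `D i` are independent and centered, so each can be
replaced by its square in turn. The weight `W` is general because the induction stores the factors
of the other coordinates in it. -/
theorem integral_mul_exp_sum_le {B : Finset ι} {D : ι → (ι → Z) → ℝ}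
    (hD : ∀ i ∈ B, BddMeasurable (D i)) (h0 : ∀ i ∈ B, ∀ S, coordAvg ν {i} (D i) S = 0)
    (hind : ∀ i ∈ B, ∀ j ∈ B, j ≠ i → IndepOfCoord j (D i)) :
    ∀ {W : (ι → Z) → ℝ}, BddMeasurable W → (∀ S, 0 ≤ W S) → (∀ i ∈ B, IndepOfCoord i W) →
    ∫ S, W S * Real.exp (∑ i ∈ B, D i S) ∂(Measure.pi fun _ => ν) ≤
      ∫ S, W S * Real.exp (∑ i ∈ B, D i S ^ 2) ∂(Measure.pi fun _ => ν) := by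
  induction B using Finset.induction_on with
  | empty => intros; simp
  | insert i B hi ih =>
    intro W hW hW0 hWi
    have hDi := hD i (by simp)
    have hDB : ∀ j ∈ B, BddMeasurable (D j) := fun j hj => hD j (by simp [hj])
    have hne : ∀ j ∈ B, j ≠ i := fun j hj h => hi (h ▸ hj)
    have h1 := ih hDB (fun j hj => h0 j (by simp [hj]))
      (fun j hj k hk hkj => hind j (by simp [hj]) k (by simp [hk]) hkj)
      (W := fun S => W S * Real.exp (D i S)) (hW.mul hDi.exp)
      (fun S => mul_nonneg (hW0 S) (Real.exp_pos _).le)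
      (fun j hj S z => by
        simp only [hWi j (by simp [hj]) S z, hind i (by simp) j (by simp [hj]) (hne j hj) S z])
    have h2 := integral_mul_exp_le_integral_mul_exp_sq (ν := ν) (i := i)
      (W := fun S => W S * Real.exp (∑ j ∈ B, D j S ^ 2)) (D := D i)
      (hW.mul (BddMeasurable.sum B fun j hj => (hDB j hj).sq).exp)
      (fun S => mul_nonneg (hW0 S) (Real.exp_pos _).le) hDi
      (fun S z => by
        have : ∀ j ∈ B, D j (Function.update S i z) ^ 2 = D j S ^ 2 := fun j hj => by
          rw [hind j (by simp [hj]) i (by simp) (hne j hj).symm S z]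
        simp only [hWi i (by simp) S z, Finset.sum_congr rfl this])
      (h0 i (by simp))
    simp only [Finset.sum_insert hi, Real.exp_add]
    simp only [← mul_assoc]
    simp only [mul_right_comm (W _) (Real.exp (∑ j ∈ B, D j _ ^ 2))] at h2
    exact h1.trans h2

/-- Coordinates of `C` are averaged out one at a time. With `Δ = f - f'` the martingale increment,
`f² = f'² + 2 f' Δ + Δ²`: the term `Δ²` costs a factor `exp (β² / u)`, and the centered cross term
costs a decrease of `u` by `4 β²`. -/
theorem integral_exp_sq_div_le {C : Finset ι} {β : ℝ} (hβ : 0 ≤ β) :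
    ∀ {u : ℝ} {f : (ι → Z) → ℝ}, BddMeasurable f → BoundedDiff C β f → 4 * C.card * β ^ 2 < u →
    ∫ S, Real.exp (f S ^ 2 / u) ∂(Measure.pi fun _ => ν) ≤
      Real.exp (C.card * β ^ 2 / (u - 4 * C.card * β ^ 2)) *
        ∫ S, Real.exp (coordAvg ν C f S ^ 2 / (u - 4 * C.card * β ^ 2))
          ∂(Measure.pi fun _ => ν) := by
  induction C using Finset.induction_on with
  | empty => intro u f _ _ _; simp [coordAvg_empty]
  | insert j C hj ih =>
    intro u f hf hd hu
    rw [Finset.card_insert_of_notMem hj] at hu ⊢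
    push_cast at hu ⊢
    set m : ℝ := ((C.card : ℕ) : ℝ) with hm
    have hm0 : 0 ≤ m := by positivity
    have hb2 : 0 ≤ β ^ 2 := by positivity
    have hmb : 0 ≤ m * β ^ 2 := by positivity
    set f' := coordAvg ν {j} f with hf'
    have hf'm : BddMeasurable f' := hf.coordAvg _
    have hu0 : 0 < u := by nlinarith
    have hu' : 0 < u - 4 * β ^ 2 := by nlinarith
    have hstep : ∫ S, Real.exp (f S ^ 2 / u) ∂(Measure.pi fun _ => ν) ≤
        Real.exp (β ^ 2 / u) *
          ∫ S, Real.exp (f' S ^ 2 / (u - 4 * β ^ 2)) ∂(Measure.pi fun _ => ν) := by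
      have hΔm : BddMeasurable (fun S => f S - f' S) := hf.sub hf'm
      have hΔ : ∀ S, |f S - f' S| ≤ β := fun S =>
        (hd.mono (by simp)).abs_sub_coordAvg_le hf S
      have hDm : BddMeasurable (fun S => 2 / u * f' S * (f S - f' S)) :=
        (hf'm.const_mul (2 / u)).mul hΔm
      have hf'i : IndepOfCoord j f' := indepOfCoord_coordAvg_of_mem (by simp) f
      have hD0 : ∀ S, coordAvg ν {j} (fun S => 2 / u * f' S * (f S - f' S)) S = 0 := by
        intro S
        have h1 : ∀ S', f' (({j} : Finset ι).piecewise S' S) = f' S := fun S' => by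
          rw [Finset.piecewise_singleton]; exact hf'i _ _
        simp only [coordAvg, h1]
        rw [integral_const_mul, integral_sub ((hf.comp_piecewise _ _).integrable _)
          (integrable_const _)]
        have : ∫ S', f (({j} : Finset ι).piecewise S' S) ∂(Measure.pi fun _ => ν) = f' S := rfl
        rw [this]; simp
      have h1 := integral_mul_exp_le_integral_mul_exp_sq (ν := ν) (i := j)
        (W := fun S => Real.exp (f' S ^ 2 / u)) (hf'm.sq.div_const u).exp
        (fun S => (Real.exp_pos _).le) hDm (fun S z => by simp only [hf'i S z]) hD0
      calc ∫ S, Real.exp (f S ^ 2 / u) ∂(Measure.pi fun _ => ν)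
          ≤ ∫ S, Real.exp (β ^ 2 / u) * (Real.exp (f' S ^ 2 / u) *
              Real.exp (2 / u * f' S * (f S - f' S))) ∂(Measure.pi fun _ => ν) := by
            refine integral_mono ((hf.sq.div_const u).exp.integrable _)
              ((((hf'm.sq.div_const u).exp.mul hDm.exp).const_mul _).integrable _) fun S => ?_
            simp only [← Real.exp_add]
            refine Real.exp_le_exp.2 ?_
            have h2 : (f S - f' S) ^ 2 ≤ β ^ 2 := sq_le_sq' (abs_le.1 (hΔ S)).1 (abs_le.1 (hΔ S)).2
            have : f S ^ 2 / u = (f S - f' S) ^ 2 / u + (f' S ^ 2 / u +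
                2 / u * f' S * (f S - f' S)) := by field_simp; ring
            rw [this]
            gcongr
        _ = Real.exp (β ^ 2 / u) * ∫ S, (Real.exp (f' S ^ 2 / u) *
              Real.exp (2 / u * f' S * (f S - f' S))) ∂(Measure.pi fun _ => ν) :=
            integral_const_mul _ _
        _ ≤ Real.exp (β ^ 2 / u) *
              ∫ S, Real.exp (f' S ^ 2 / (u - 4 * β ^ 2)) ∂(Measure.pi fun _ => ν) := by
            refine mul_le_mul_of_nonneg_left (h1.trans ?_) (Real.exp_pos _).le
            refine integral_mono (((hf'm.sq.div_const u).exp.mul hDm.sq.exp).integrable _)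
              ((hf'm.sq.div_const _).exp.integrable _) fun S => ?_
            simp only [← Real.exp_add]
            refine Real.exp_le_exp.2 ?_
            have h2 : (f S - f' S) ^ 2 ≤ β ^ 2 := sq_le_sq' (abs_le.1 (hΔ S)).1 (abs_le.1 (hΔ S)).2
            have h3 : (2 / u * f' S * (f S - f' S)) ^ 2 ≤ 4 / u ^ 2 * f' S ^ 2 * β ^ 2 := by
              have : (2 / u * f' S * (f S - f' S)) ^ 2 =
                4 / u ^ 2 * f' S ^ 2 * (f S - f' S) ^ 2 := by ring
              rw [this]; gcongr
            -- Equivalent to `(u + 4 β²)(u - 4 β²) ≤ u²`.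
            have h4 : 1 / u + 4 * β ^ 2 / u ^ 2 ≤ 1 / (u - 4 * β ^ 2) := by
              rw [div_add_div _ _ hu0.ne' (by positivity), div_le_div_iff₀ (by positivity) hu']
              nlinarith [mul_nonneg hu0.le (sq_nonneg (β ^ 2))]
            calc f' S ^ 2 / u + (2 / u * f' S * (f S - f' S)) ^ 2
                ≤ f' S ^ 2 / u + 4 / u ^ 2 * f' S ^ 2 * β ^ 2 := by gcongr
              _ = f' S ^ 2 * (1 / u + 4 * β ^ 2 / u ^ 2) := by ring
              _ ≤ f' S ^ 2 * (1 / (u - 4 * β ^ 2)) := by gcongr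
              _ = f' S ^ 2 / (u - 4 * β ^ 2) := by ring
    have hIH := ih (u := u - 4 * β ^ 2) (f := f') hf'm
      ((hd.mono (Finset.subset_insert _ _)).coordAvg hβ hf _) (by linarith)
    have huu : u - 4 * β ^ 2 - 4 * m * β ^ 2 = u - 4 * (m + 1) * β ^ 2 := by ring
    have hcc : coordAvg ν C f' = coordAvg ν (insert j C) f := by
      rw [hf', coordAvg_coordAvg _ _ hf, Finset.union_comm]; rfl
    rw [huu, hcc] at hIH
    have hv : 0 < u - 4 * (m + 1) * β ^ 2 := by linarith
    calc _ ≤ _ := hstep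
      _ ≤ Real.exp (β ^ 2 / u) * _ := mul_le_mul_of_nonneg_left hIH (Real.exp_pos _).le
      _ ≤ _ := by
        rw [← mul_assoc, ← Real.exp_add]
        refine mul_le_mul_of_nonneg_right (Real.exp_le_exp.2 ?_)
          (integral_nonneg fun S => (Real.exp_pos _).le)
        have : β ^ 2 / u ≤ β ^ 2 / (u - 4 * (m + 1) * β ^ 2) :=
          div_le_div_of_nonneg_left hb2 hv (by nlinarith)
        calc _ ≤ β ^ 2 / (u - 4 * (m + 1) * β ^ 2) + m * β ^ 2 / (u - 4 * (m + 1) * β ^ 2) := by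
              gcongr
          _ = (m + 1) * β ^ 2 / (u - 4 * (m + 1) * β ^ 2) := by ring

/-- Two square-root cancellations give the scale `m β`: each `D i` has size `√m β`, being centered
over `C` with differences `β`, and the sum over `B` gains only `√m`, its terms being conditionally
independent. -/
theorem integral_exp_sum_div_le_two {B C : Finset ι} {m : ℕ} (hm : 0 < m) (hB : B.card ≤ m)
    (hC : C.card ≤ m) {β : ℝ} (hβ : 0 < β) {D : ι → (ι → Z) → ℝ}
    (hD : ∀ i ∈ B, BddMeasurable (D i)) (h0 : ∀ i ∈ B, ∀ S, coordAvg ν {i} (D i) S = 0)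
    (hind : ∀ i ∈ B, ∀ j ∈ B, j ≠ i → IndepOfCoord j (D i))
    (hd : ∀ i ∈ B, BoundedDiff C β (D i)) (hC0 : ∀ i ∈ B, ∀ S, coordAvg ν C (D i) S = 0) :
    ∫ S, Real.exp ((∑ i ∈ B, D i S) / (3 * m * β)) ∂(Measure.pi fun _ => ν) ≤ 2 := by
  rcases B.eq_empty_or_nonempty with rfl | hne
  · simp
  have hm' : (0 : ℝ) < m := by exact_mod_cast hm
  have hCm : (C.card : ℝ) ≤ m := by exact_mod_cast hC
  have hBm : (B.card : ℝ) ≤ m := by exact_mod_cast hB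
  have hB0 : (0 : ℝ) < B.card := by exact_mod_cast hne.card_pos
  set s : ℝ := 3 * m * β with hs
  have hs0 : 0 < s := by positivity
  have hz : ∀ i ∈ B, ∀ S, coordAvg ν {i} (fun S => D i S / s) S = 0 := by
    intro i hi S
    have := h0 i hi S
    simp only [coordAvg] at this ⊢
    rw [integral_div, this, zero_div]
  have h1 := integral_mul_exp_sum_le (ν := ν) (B := B) (D := fun i S => D i S / s)
    (fun i hi => (hD i hi).div_const s) hz
    (fun i hi j hj hij S z => by simp only [hind i hi j hj hij S z])
    (W := fun _ => 1) (BddMeasurable.const 1) (fun _ => zero_le_one) (fun _ _ _ _ => rfl)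
  simp only [one_mul, ← Finset.sum_div] at h1
  refine h1.trans ?_
  have hterm : ∀ i ∈ B, ∫ S, Real.exp (D i S ^ 2 / (9 * m * β ^ 2)) ∂(Measure.pi fun _ => ν) ≤ 2 := by
    intro i hi
    have hmb : C.card * β ^ 2 ≤ m * β ^ 2 := by gcongr
    have hmb0 : 0 < m * β ^ 2 := by positivity
    have := integral_exp_sq_div_le (ν := ν) hβ.le (u := 9 * m * β ^ 2) (hD i hi) (hd i hi)
      (by nlinarith)
    refine this.trans ?_
    simp only [hC0 i hi]
    simp only [ne_eq, OfNat.ofNat_ne_zero, not_false_eq_true, zero_pow, zero_div, Real.exp_zero,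
      integral_const, probReal_univ, smul_eq_mul, mul_one]
    have : C.card * β ^ 2 / (9 * m * β ^ 2 - 4 * C.card * β ^ 2) ≤ 1 / 2 := by
      rw [div_le_div_iff₀ (by nlinarith) (by norm_num)]
      nlinarith
    calc Real.exp _ ≤ Real.exp (1 / 2) := Real.exp_le_exp.2 this
      _ ≤ 2 := by
        have h := Real.exp_one_lt_d9
        have h2 : Real.exp (1 / 2) * Real.exp (1 / 2) = Real.exp 1 := by
          rw [← Real.exp_add]; norm_num
        nlinarith [Real.exp_pos (1 / 2)]
  calc ∫ S, Real.exp (∑ i ∈ B, (D i S / s) ^ 2) ∂(Measure.pi fun _ => ν)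
      ≤ ∫ S, ∑ i ∈ B, 1 / (B.card : ℝ) * Real.exp (D i S ^ 2 / (9 * m * β ^ 2))
          ∂(Measure.pi fun _ => ν) := by
        refine integral_mono
          ((BddMeasurable.sum B fun i hi => ((hD i hi).div_const s).sq).exp.integrable _)
          ((BddMeasurable.sum B fun i hi =>
            ((hD i hi).sq.div_const _).exp.const_mul _).integrable _) fun S => ?_
        -- Jensen: as `s² = 9 m² β²` and `B.card ≤ m`, the sum of `(D i / s)²` is at most the mean
        -- over `B` of `D i ² / (9 m β²)`.
        have hconv := convexOn_exp.map_sum_le (t := B) (w := fun _ => 1 / (B.card : ℝ))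
          (p := fun i => D i S ^ 2 / (9 * m * β ^ 2)) (fun _ _ => by positivity)
          (by simp [hB0.ne']) (fun _ _ => Set.mem_univ _)
        simp only [smul_eq_mul] at hconv
        refine le_trans (Real.exp_le_exp.2 (Finset.sum_le_sum fun i _ => ?_)) hconv
        rw [div_pow, hs, one_div_mul_eq_div, div_div]
        refine div_le_div_of_nonneg_left (sq_nonneg _) (by positivity) ?_
        have : 9 * m * β ^ 2 * B.card ≤ 9 * m * β ^ 2 * m := by gcongr
        nlinarith
    _ = ∑ i ∈ B, 1 / (B.card : ℝ) *
          ∫ S, Real.exp (D i S ^ 2 / (9 * m * β ^ 2)) ∂(Measure.pi fun _ => ν) := by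
        rw [integral_finsetSum _ fun i hi =>
          (((hD i hi).sq.div_const _).exp.const_mul _).integrable _]
        simp only [integral_const_mul]
    _ ≤ ∑ i ∈ B, 1 / (B.card : ℝ) * 2 :=
        Finset.sum_le_sum fun i hi => mul_le_mul_of_nonneg_left (hterm i hi) (by positivity)
    _ = 2 := by simp [hB0.ne']

/-- Convexity of `exp`: scales add as for an Orlicz norm, without any independence. -/
theorem integral_exp_add_div_le {α : Type*} [MeasurableSpace α] {μ : Measure α}
    [IsProbabilityMeasure μ] {X Y : α → ℝ} {s t c : ℝ} (hX : BddMeasurable X)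
    (hY : BddMeasurable Y) (hs : 0 < s) (ht : 0 < t)
    (hXs : ∫ x, Real.exp (X x / s) ∂μ ≤ c) (hYt : ∫ x, Real.exp (Y x / t) ∂μ ≤ c) :
    ∫ x, Real.exp ((X x + Y x) / (s + t)) ∂μ ≤ c := by
  calc ∫ x, Real.exp ((X x + Y x) / (s + t)) ∂μ
      ≤ ∫ x, (s / (s + t) * Real.exp (X x / s) + t / (s + t) * Real.exp (Y x / t)) ∂μ := by
        refine integral_mono (((hX.add hY).div_const _).exp.integrable _)
          ((((hX.div_const s).exp.const_mul _).add ((hY.div_const t).exp.const_mul _)).integrable _)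
          fun x => ?_
        have := convexOn_exp.2 (Set.mem_univ (X x / s)) (Set.mem_univ (Y x / t))
          (show 0 ≤ s / (s + t) by positivity) (show 0 ≤ t / (s + t) by positivity)
          (by field_simp)
        simp only [smul_eq_mul] at this
        refine le_trans (le_of_eq ?_) this
        congr 1
        field_simp
    _ = s / (s + t) * ∫ x, Real.exp (X x / s) ∂μ + t / (s + t) * ∫ x, Real.exp (Y x / t) ∂μ := by
        rw [integral_add (((hX.div_const s).exp.const_mul _).integrable _)
          (((hY.div_const t).exp.const_mul _).integrable _), integral_const_mul, integral_const_mul]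
    _ ≤ s / (s + t) * c + t / (s + t) * c := by gcongr
    _ = c := by field_simp

/-- One level of the dyadic splitting. The term with index `i` ignores the rest of `B`, and
averaging it over `C` gives zero because both parts then have the same average. -/
theorem integral_exp_sum_coordAvg_sub_coordAvg_le_two {β : ℝ} (hβ : 0 < β)
    {g : ι → (ι → Z) → ℝ} (hg : ∀ i, BddMeasurable (g i))
    (h0 : ∀ i S, coordAvg ν {i} (g i) S = 0)
    (hd : ∀ i, BoundedDiff (Finset.univ.erase i) β (g i)) {m : ℕ} (hm : 0 < m)
    {B C : Finset ι} (hBC : Disjoint B C) (hB : B.card ≤ m) (hC : C.card ≤ m) :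
    ∫ S, Real.exp ((∑ i ∈ B, (coordAvg ν (B.erase i) (g i) S -
      coordAvg ν ((B ∪ C).erase i) (g i) S)) / (3 * m * β)) ∂(Measure.pi fun _ => ν) ≤ 2 := by
  refine integral_exp_sum_div_le_two hm hB hC hβ
    (fun i _ => ((hg i).coordAvg _).sub ((hg i).coordAvg _)) ?_ ?_ ?_ ?_
  · intro i hi S
    have hzero : ∀ A : Finset ι, coordAvg ν {i} (coordAvg ν A (g i)) = fun _ => 0 := by
      intro A
      rw [coordAvg_coordAvg _ _ (hg i), Finset.union_comm, ← coordAvg_coordAvg _ _ (hg i),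
        funext (h0 i), coordAvg_zero]
    rw [coordAvg_sub _ ((hg i).coordAvg _) ((hg i).coordAvg _), hzero, hzero, sub_self]
  · intro i hi j hj hji S z
    simp only
    rw [indepOfCoord_coordAvg_of_mem (Finset.mem_erase.2 ⟨hji, hj⟩),
      indepOfCoord_coordAvg_of_mem
        (Finset.mem_erase.2 ⟨hji, Finset.mem_union_left _ hj⟩)]
  · intro i hi j hj S z
    have hij : j ≠ i := fun h => Finset.disjoint_left.1 hBC hi (h ▸ hj)
    simp only
    rw [indepOfCoord_coordAvg_of_mem (B := (B ∪ C).erase i)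
      (Finset.mem_erase.2 ⟨hij, Finset.mem_union_right _ hj⟩), sub_sub_sub_cancel_right]
    exact (hd i).coordAvg hβ.le (hg i) _ j (by simp [hij]) S z
  · intro i hi S
    have hiC : i ∉ C := Finset.disjoint_left.1 hBC hi
    rw [coordAvg_sub _ ((hg i).coordAvg _) ((hg i).coordAvg _), coordAvg_coordAvg _ _ (hg i),
      coordAvg_coordAvg _ _ (hg i)]
    have h1 : C ∪ B.erase i = C ∪ (B ∪ C).erase i := by
      ext j
      simp only [Finset.mem_union, Finset.mem_erase]
      tauto
    rw [h1, sub_self]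

/-- Exponential moments of a sum of weakly dependent terms, by dyadic splitting of the index set:
each `g i` is centered in the coordinate `i` and has bounded differences in the others. -/
theorem integral_exp_sum_sub_coordAvg_le_two {β : ℝ} (hβ : 0 < β) {g : ι → (ι → Z) → ℝ}
    (hg : ∀ i, BddMeasurable (g i)) (h0 : ∀ i S, coordAvg ν {i} (g i) S = 0)
    (hd : ∀ i, BoundedDiff (Finset.univ.erase i) β (g i)) (k : ℕ) :
    ∀ B : Finset ι, B.card ≤ 2 ^ k →
    ∫ S, Real.exp ((∑ i ∈ B, (g i S - coordAvg ν (B.erase i) (g i) S)) /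
      ((k + 1) * 2 ^ k * (3 * β))) ∂(Measure.pi fun _ => ν) ≤ 2 := by
  induction k with
  | zero =>
    intro B hB
    -- For at most one index nothing is averaged. The factor `k + 1` instead of `k` only keeps the
    -- scale positive here.
    have hsum : ∀ S, ∑ i ∈ B, (g i S - coordAvg ν (B.erase i) (g i) S) = 0 := by
      intro S
      refine Finset.sum_eq_zero fun i hi => ?_
      have : B.erase i = ∅ := by
        rw [← Finset.card_eq_zero, Finset.card_erase_of_mem hi]
        simp at hB
        omega
      rw [this, coordAvg_empty, sub_self]
    simp [hsum]
  | succ k ih =>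
    intro B hB
    obtain ⟨B₁, hB₁, hc₁⟩ := Finset.exists_subset_card_eq (s := B) (n := B.card / 2) (by omega)
    obtain ⟨B₂, hB₂⟩ : ∃ B₂, B₂ = B \ B₁ := ⟨_, rfl⟩
    have hdisj : Disjoint B₁ B₂ := hB₂ ▸ Finset.disjoint_sdiff
    have hunion : B₁ ∪ B₂ = B := hB₂ ▸ Finset.union_sdiff_of_subset hB₁
    have hcard : B₁.card + B₂.card = B.card := by
      rw [← Finset.card_union_of_disjoint hdisj, hunion]
    have hk₁ : B₁.card ≤ 2 ^ k := by rw [pow_succ] at hB; omega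
    have hk₂ : B₂.card ≤ 2 ^ k := by rw [pow_succ] at hB; omega
    have hterm : ∀ A A' : Finset ι, BddMeasurable (fun S => ∑ i ∈ A',
        (coordAvg ν (A'.erase i) (g i) S - coordAvg ν (A.erase i) (g i) S)) := fun A A' =>
      BddMeasurable.sum _ fun i _ => ((hg i).coordAvg _).sub ((hg i).coordAvg _)
    have hterm' : ∀ A : Finset ι, BddMeasurable (fun S => ∑ i ∈ A,
        (g i S - coordAvg ν (A.erase i) (g i) S)) := fun A =>
      BddMeasurable.sum _ fun i _ => (hg i).sub ((hg i).coordAvg _)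
    have hD₁ := integral_exp_sum_coordAvg_sub_coordAvg_le_two (ν := ν) hβ hg h0 hd
      (pow_pos two_pos k) hdisj hk₁ hk₂
    have hD₂ := integral_exp_sum_coordAvg_sub_coordAvg_le_two (ν := ν) hβ hg h0 hd
      (pow_pos two_pos k) hdisj.symm hk₂ hk₁
    rw [hunion] at hD₁
    rw [Finset.union_comm, hunion] at hD₂
    push_cast at hD₁ hD₂
    have hs : (0 : ℝ) < (k + 1) * 2 ^ k * (3 * β) := by positivity
    have ht : (0 : ℝ) < 3 * 2 ^ k * β := by positivity
    have h₁ := integral_exp_add_div_le (hterm' B₁) (hterm B B₁) hs ht (ih B₁ hk₁) hD₁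
    have h₂ := integral_exp_add_div_le (hterm' B₂) (hterm B B₂) hs ht (ih B₂ hk₂) hD₂
    have h := integral_exp_add_div_le ((hterm' B₁).add (hterm B B₁))
      ((hterm' B₂).add (hterm B B₂)) (add_pos hs ht) (add_pos hs ht) h₁ h₂
    refine le_trans (le_of_eq (integral_congr_ae (Filter.Eventually.of_forall fun S => ?_))) h
    simp only
    congr 2
    -- For `i` in a half, insert the average over that half without `i`; the two differences
    -- telescope. The scales satisfy `s (k+1) = 2 (s k + 3 · 2 ^ k · β)`.
    · conv_lhs => rw [← hunion]
      rw [Finset.sum_union hdisj]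
      simp only [← Finset.sum_add_distrib, sub_add_sub_cancel, hunion]
    · push_cast
      ring

end Concentration

/-! ### Deviation of the training loss of a stable learner from its population loss. -/

section Deviation

theorem measure_log_div_lt_le {α : Type*} [MeasurableSpace α] {μ : Measure α}
    [IsProbabilityMeasure μ] {X : α → ℝ} (hX : BddMeasurable X) {K δ : ℝ} (hK : 0 < K)
    (hδ : 0 < δ) (h : ∫ x, Real.exp (X x) ∂μ ≤ K) :
    μ {x | Real.log (K / δ) < X x} ≤ ENNReal.ofReal δ := by
  have h1 := mul_meas_ge_le_integral_of_nonneg (μ := μ)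
    (Filter.Eventually.of_forall fun x => (Real.exp_pos (X x)).le) (hX.exp.integrable μ) (K / δ)
  have h2 : μ.real {x | K / δ ≤ Real.exp (X x)} ≤ δ := by
    have h3 := h1.trans h
    rw [div_mul_eq_mul_div, div_le_iff₀ hδ] at h3
    exact le_of_mul_le_mul_left h3 hK
  have hsub : {x | Real.log (K / δ) < X x} ⊆ {x | K / δ ≤ Real.exp (X x)} := fun x hx =>
    ((Real.log_lt_iff_lt_exp (div_pos hK hδ)).1 hx).le
  refine (measure_mono hsub).trans ?_
  exact (ENNReal.le_ofReal_iff_toReal_le (measure_ne_top μ _) hδ.le).2 h2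

variable {ι Z : Type*} [Fintype ι] [DecidableEq ι] [MeasurableSpace Z]
variable {ν : Measure Z} [IsProbabilityMeasure ν]

theorem integral_comp_eval {h : Z → ℝ} (hh : Measurable h) (i : ι) :
    ∫ S, h (S i) ∂(Measure.pi fun _ : ι => ν) = ∫ z, h z ∂ν := by
  have hmp := measurePreserving_eval (fun _ : ι => ν) i
  conv_rhs => rw [← hmp.map_eq]
  rw [integral_map hmp.measurable.aemeasurable hh.aestronglyMeasurable]

section Chernoff

variable {v : Z → ℝ} {M : ℝ}

/-- Combines `exp x ≤ 1 + x + x²` for `|x| ≤ 1` with `v² ≤ M v`. The exponent is thus proportional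
to the mean of `v`, the source of the multiplicative form of the final bound. -/
theorem integral_exp_mul_sub_integral_le (hv : Measurable v) (hM : ∀ z, 0 ≤ v z ∧ v z ≤ M)
    {c : ℝ} (hc : |c| * M ≤ 1) :
    ∫ z, Real.exp (c * (v z - ∫ z', v z' ∂ν)) ∂ν ≤ Real.exp (c ^ 2 * M * ∫ z, v z ∂ν) := by
  set V := ∫ z', v z' ∂ν with hV
  have hvb : BddMeasurable v := BddMeasurable.of_mem_Icc hv hM
  have h1 : ∀ z, Real.exp (c * v z) ≤ 1 + c * v z + c ^ 2 * M * v z := by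
    intro z
    have : |c * v z| ≤ 1 := by
      rw [abs_mul, abs_of_nonneg (hM z).1]
      exact (mul_le_mul_of_nonneg_left (hM z).2 (abs_nonneg c)).trans hc
    have h2 := (abs_le.1 (Real.abs_exp_sub_one_sub_id_le this)).2
    have h3 : (c * v z) ^ 2 ≤ c ^ 2 * M * v z := by
      have := mul_le_mul_of_nonneg_left (hM z).2 (mul_nonneg (sq_nonneg c) (hM z).1)
      nlinarith
    linarith
  have h2 : ∫ z, Real.exp (c * v z) ∂ν ≤ 1 + c * V + c ^ 2 * M * V := by
    calc ∫ z, Real.exp (c * v z) ∂ν ≤ ∫ z, (1 + (c + c ^ 2 * M) * v z) ∂ν := by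
          refine integral_mono ((hvb.const_mul c).exp.integrable ν)
            (((BddMeasurable.const 1).add (hvb.const_mul _)).integrable ν) fun z => ?_
          have := h1 z
          simp only
          linarith
      _ = 1 + (c + c ^ 2 * M) * V := by
          rw [integral_add (integrable_const _) ((hvb.const_mul _).integrable ν),
            integral_const_mul]
          simp [hV]
      _ = 1 + c * V + c ^ 2 * M * V := by ring
  have h3 : ∫ z, Real.exp (c * (v z - V)) ∂ν =
      Real.exp (-(c * V)) * ∫ z, Real.exp (c * v z) ∂ν := by
    rw [← integral_const_mul]
    refine integral_congr_ae (Filter.Eventually.of_forall fun z => ?_)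
    simp only [← Real.exp_add]
    congr 1
    ring
  rw [h3]
  calc Real.exp (-(c * V)) * ∫ z, Real.exp (c * v z) ∂ν
      ≤ Real.exp (-(c * V)) * Real.exp (c * V + c ^ 2 * M * V) := by
        refine mul_le_mul_of_nonneg_left (h2.trans ?_) (Real.exp_pos _).le
        have := Real.add_one_le_exp (c * V + c ^ 2 * M * V)
        linarith
    _ = Real.exp (c ^ 2 * M * V) := by
        rw [← Real.exp_add]
        congr 1
        ring

theorem measure_chernoff_le (hv : Measurable v) (hM : ∀ z, 0 ≤ v z ∧ v z ≤ M)
    {c δ : ℝ} (hc : |c| * M ≤ 1) (hδ : 0 < δ) :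
    (Measure.pi fun _ : ι => ν) {S | Fintype.card ι * (c ^ 2 * M * ∫ z, v z ∂ν) +
      Real.log (1 / δ) < ∑ i, c * (v (S i) - ∫ z, v z ∂ν)} ≤ ENNReal.ofReal δ := by
  set V := ∫ z', v z' ∂ν with hV
  have hvb : BddMeasurable v := BddMeasurable.of_mem_Icc hv hM
  have hXm : BddMeasurable (fun S : ι → Z => (∑ i, c * (v (S i) - V)) -
      Fintype.card ι * (c ^ 2 * M * V)) :=
    (BddMeasurable.sum _ fun i _ => ((hvb.comp (measurable_pi_apply i)).sub
      (BddMeasurable.const V)).const_mul c).sub (BddMeasurable.const _)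
  have := measure_log_div_lt_le (μ := Measure.pi fun _ : ι => ν) hXm one_pos hδ ?_
  · simpa only [lt_sub_iff_add_lt'] using this
  · have h1 : ∀ S : ι → Z, Real.exp ((∑ i, c * (v (S i) - V)) -
        Fintype.card ι * (c ^ 2 * M * V)) =
        (∏ i, Real.exp (c * (v (S i) - V))) * Real.exp (-(Fintype.card ι * (c ^ 2 * M * V))) := by
      intro S
      rw [← Real.exp_sum, ← Real.exp_add, sub_eq_add_neg]
    simp only [h1]
    rw [integral_mul_const,
      integral_fintype_prod_eq_pow (μ := ν) (fun z => Real.exp (c * (v z - V)))]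
    calc _ ≤ Real.exp (c ^ 2 * M * V) ^ Fintype.card ι *
          Real.exp (-(Fintype.card ι * (c ^ 2 * M * V))) := by
          refine mul_le_mul_of_nonneg_right (pow_le_pow_left₀ ?_ ?_ _) (Real.exp_pos _).le
          · exact integral_nonneg fun z => (Real.exp_pos _).le
          · exact integral_exp_mul_sub_integral_le hv hM hc
      _ = 1 := by rw [← Real.exp_nat_mul, ← Real.exp_add, add_neg_cancel, Real.exp_zero]

end Chernoff

/-- A loss `f (S, z)` of a learner trained on `S`, which takes values in `[0, M]` and changes by at
most `γ` when one training point is replaced. -/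
structure StableLoss (f : (ι → Z) × Z → ℝ) (M γ : ℝ) : Prop where
  measurable : Measurable f
  mem_Icc : ∀ p, 0 ≤ f p ∧ f p ≤ M
  stable : ∀ S i z' z, |f (Function.update S i z', z) - f (S, z)| ≤ γ

namespace StableLoss

variable {f : (ι → Z) × Z → ℝ} {M γ : ℝ}

theorem bdd (hf : StableLoss f M γ) : BddMeasurable f := .of_mem_Icc hf.measurable hf.mem_Icc

theorem bdd_left (hf : StableLoss f M γ) (S : ι → Z) : BddMeasurable (fun z => f (S, z)) :=
  hf.bdd.comp measurable_prodMk_left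

theorem bdd_right (hf : StableLoss f M γ) (z : Z) : BddMeasurable (fun S => f (S, z)) :=
  hf.bdd.comp measurable_prodMk_right

/-- Passing to `M - f` reverses the sign of the gap, so one tail bound serves both directions. -/
theorem complement (hf : StableLoss f M γ) : StableLoss (fun p => M - f p) M γ where
  measurable := measurable_const.sub hf.measurable
  mem_Icc p := ⟨by linarith [(hf.mem_Icc p).2], by linarith [(hf.mem_Icc p).1]⟩
  stable S i z' z := by
    have := hf.stable S i z' z
    rw [abs_sub_comm] at this
    convert this using 2
    ring

variable (ν) in
/-- The population loss of the learner trained on `S`, minus its loss on the `i`-th training point,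
when that point is replaced by a fresh sample during training. -/
noncomputable def resampledGap (f : (ι → Z) × Z → ℝ) (i : ι) (S : ι → Z) : ℝ :=
  coordAvg ν {i} (fun S => ∫ z, f (S, z) ∂ν) S -
    ∫ S', f (({i} : Finset ι).piecewise S' S, S i) ∂(Measure.pi fun _ => ν)

theorem bdd_popLoss (hf : StableLoss f M γ) : BddMeasurable (fun S => ∫ z, f (S, z) ∂ν) :=
  hf.bdd.integral_prod_right ν

theorem bdd_comp_piecewise_eval (hf : StableLoss f M γ) (i : ι) :
    BddMeasurable (fun p : (ι → Z) × (ι → Z) => f (({i} : Finset ι).piecewise p.2 p.1, p.1 i)) :=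
  hf.bdd.comp (((measurable_finset_piecewise {i}).comp measurable_swap).prodMk
    ((measurable_pi_apply i).comp measurable_fst))

theorem bdd_resampledLoss (hf : StableLoss f M γ) (i : ι) : BddMeasurable (fun S : ι → Z =>
    ∫ S', f (({i} : Finset ι).piecewise S' S, S i) ∂(Measure.pi fun _ => ν)) :=
  (hf.bdd_comp_piecewise_eval i).integral_prod_right _

theorem bdd_resampledGap (hf : StableLoss f M γ) (i : ι) :
    BddMeasurable (resampledGap ν f i) :=
  (hf.bdd_popLoss.coordAvg {i}).sub (hf.bdd_resampledLoss i)

theorem bdd_eval (hf : StableLoss f M γ) (i : ι) : BddMeasurable (fun S => f (S, S i)) :=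
  hf.bdd.comp (measurable_id.prodMk (measurable_pi_apply i))

/-- After resampling, the learner no longer sees `S i`, which is then a fresh test point. -/
theorem coordAvg_singleton_resampledGap (hf : StableLoss f M γ) (i : ι) (S : ι → Z) :
    coordAvg ν {i} (resampledGap ν f i) S = 0 := by
  unfold resampledGap
  rw [coordAvg_sub _ (hf.bdd_popLoss.coordAvg {i}) (hf.bdd_resampledLoss i),
    coordAvg_coordAvg _ _ hf.bdd_popLoss, Finset.union_self, sub_eq_zero]
  have h1 : ∀ S₁ S₂ : ι → Z, ({i} : Finset ι).piecewise S₂ (({i} : Finset ι).piecewise S₁ S) =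
      ({i} : Finset ι).piecewise S₂ S := by
    intro S₁ S₂
    simp only [Finset.piecewise_singleton, Function.update_idem]
  have h2 : ∀ S₁ : ι → Z, ({i} : Finset ι).piecewise S₁ S i = S₁ i := fun S₁ => by simp
  simp only [coordAvg, h1, h2]
  have hpw : Measurable (fun S' : ι → Z => ({i} : Finset ι).piecewise S' S) :=
    (measurable_finset_piecewise {i}).comp (measurable_id.prodMk measurable_const)
  have hF : BddMeasurable (fun p : (ι → Z) × Z => f (({i} : Finset ι).piecewise p.1 S, p.2)) :=
    hf.bdd.comp ((hpw.comp measurable_fst).prodMk measurable_snd)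
  rw [integral_integral_swap (hF.integrable _)]
  have := integral_comp_eval (ν := ν) (h := fun z =>
    ∫ S', f (({i} : Finset ι).piecewise S' S, z) ∂(Measure.pi fun _ => ν))
    ((hF.comp measurable_swap).integral_prod_right _).measurable i
  exact this.symm

theorem coordAvg_erase_resampledGap (hf : StableLoss f M γ) (i : ι) (S : ι → Z) :
    coordAvg ν (Finset.univ.erase i) (resampledGap ν f i) S =
      ∫ S', ∫ z, f (S', z) ∂ν ∂(Measure.pi fun _ => ν) -
        ∫ S', f (S', S i) ∂(Measure.pi fun _ => ν) := by
  unfold resampledGap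
  rw [coordAvg_sub _ (hf.bdd_popLoss.coordAvg {i}) (hf.bdd_resampledLoss i),
    coordAvg_coordAvg _ _ hf.bdd_popLoss]
  congr 1
  · have : Finset.univ.erase i ∪ {i} = (Finset.univ : Finset ι) := by
      ext j; simp
    rw [this]
    simp [coordAvg]
  · have h1 : ∀ S₁ S₂ : ι → Z, ({i} : Finset ι).piecewise S₂
        ((Finset.univ.erase i).piecewise S₁ S) = ({i} : Finset ι).piecewise S₂ S₁ := by
      intro S₁ S₂
      ext j
      by_cases h : j = i
      · subst h; simp
      · simp [h]
    have h2 : ∀ S₁ : ι → Z, (Finset.univ.erase i).piecewise S₁ S i = S i := fun S₁ => by simp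
    simp only [coordAvg, h1, h2]
    exact integral_integral_piecewise {i} (f := fun S' => f (S', S i))
      (hf.bdd_right _)

theorem boundedDiff_popLoss (hf : StableLoss f M γ) (B : Finset ι) :
    BoundedDiff B γ (fun S => ∫ z, f (S, z) ∂ν) := by
  intro j _ S z
  simp only
  rw [← integral_sub ((hf.bdd_left _).integrable _) ((hf.bdd_left _).integrable _)]
  exact abs_integral_le_of_abs_le fun z' => hf.stable S j z z'

theorem boundedDiff_resampledGap (hf : StableLoss f M γ) (hγ : 0 ≤ γ) (i : ι) :
    BoundedDiff (Finset.univ.erase i) (2 * γ) (resampledGap ν f i) := by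
  intro j hj S z
  have hji : j ≠ i := Finset.ne_of_mem_erase hj
  have h1 := (hf.boundedDiff_popLoss (ν := ν) {j}).coordAvg (ν := ν) hγ hf.bdd_popLoss {i} j
    (by simp) S z
  have h2 : |∫ S', f (({i} : Finset ι).piecewise S' (Function.update S j z),
      Function.update S j z i) ∂(Measure.pi fun _ => ν) -
      ∫ S', f (({i} : Finset ι).piecewise S' S, S i) ∂(Measure.pi fun _ => ν)| ≤ γ := by
    have hm : ∀ S₀ : ι → Z, ∀ z₀ : Z, BddMeasurable (fun S' : ι → Z =>
        f (({i} : Finset ι).piecewise S' S₀, z₀)) := fun S₀ z₀ =>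
      hf.bdd.comp (((measurable_finset_piecewise {i}).comp
        (measurable_id.prodMk measurable_const)).prodMk measurable_const)
    rw [← integral_sub ((hm _ _).integrable _) ((hm _ _).integrable _)]
    refine abs_integral_le_of_abs_le fun S' => ?_
    rw [Function.update_of_ne hji.symm,
      ← Finset.update_piecewise_of_notMem _ _ _ (by simpa using hji)]
    exact hf.stable _ _ _ _
  unfold resampledGap
  rw [abs_le] at *
  constructor <;> linarith [h1.1, h1.2, h2.1, h2.2]

theorem abs_gap_sub_resampledGap_le (hf : StableLoss f M γ) (i : ι) (S : ι → Z) :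
    |(∫ z, f (S, z) ∂ν - f (S, S i)) - resampledGap ν f i S| ≤ 2 * γ := by
  have h1 := (hf.boundedDiff_popLoss (ν := ν) {i}).abs_sub_coordAvg_le (ν := ν) hf.bdd_popLoss S
  have h2 : |∫ S', f (({i} : Finset ι).piecewise S' S, S i) ∂(Measure.pi fun _ => ν) -
      f (S, S i)| ≤ γ := by
    have : f (S, S i) = ∫ _ : ι → Z, f (S, S i) ∂(Measure.pi fun _ => ν) := by simp
    conv_lhs => rw [this]
    have hm : BddMeasurable (fun S' : ι → Z => f (({i} : Finset ι).piecewise S' S, S i)) :=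
      hf.bdd.comp (((measurable_finset_piecewise {i}).comp
        (measurable_id.prodMk measurable_const)).prodMk measurable_const)
    rw [← integral_sub (hm.integrable _) (integrable_const _)]
    refine abs_integral_le_of_abs_le fun S' => ?_
    rw [Finset.piecewise_singleton]
    exact hf.stable _ _ _ _
  unfold resampledGap
  rw [abs_le] at *
  constructor <;> linarith [h1.1, h1.2, h2.1, h2.2]

/-- In expectation, the population loss and the training loss of a stable learner are close. -/
theorem abs_integral_gap_le (hf : StableLoss f M γ) :
    |Fintype.card ι * ∫ S, ∫ z, f (S, z) ∂ν ∂(Measure.pi fun _ => ν) -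
      ∫ S, ∑ i, f (S, S i) ∂(Measure.pi fun _ : ι => ν)| ≤ Fintype.card ι * (2 * γ) := by
  have h0 : ∀ i, ∫ S, resampledGap ν f i S ∂(Measure.pi fun _ => ν) = 0 := by
    intro i
    rw [← integral_coordAvg {i} (hf.bdd_resampledGap i)]
    simp [hf.coordAvg_singleton_resampledGap i]
  have h1 : ∀ i, |∫ S, ∫ z, f (S, z) ∂ν ∂(Measure.pi fun _ => ν) -
      ∫ S, f (S, S i) ∂(Measure.pi fun _ => ν)| ≤ 2 * γ := by
    intro i
    have := abs_integral_le_of_abs_le (μ := Measure.pi fun _ : ι => ν)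
      (hf.abs_gap_sub_resampledGap_le (ν := ν) i)
    rwa [integral_sub ((hf.bdd_popLoss.sub (hf.bdd_eval i)).integrable _)
      ((hf.bdd_resampledGap i).integrable _), h0, sub_zero,
      integral_sub (hf.bdd_popLoss.integrable _) ((hf.bdd_eval i).integrable _)] at this
  rw [integral_finsetSum _ fun i _ => (hf.bdd_eval i).integrable _]
  have h2 : Fintype.card ι * ∫ S, ∫ z, f (S, z) ∂ν ∂(Measure.pi fun _ => ν) -
      ∑ i, ∫ S, f (S, S i) ∂(Measure.pi fun _ : ι => ν) =
      ∑ i : ι, (∫ S, ∫ z, f (S, z) ∂ν ∂(Measure.pi fun _ => ν) -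
        ∫ S, f (S, S i) ∂(Measure.pi fun _ : ι => ν)) := by
    simp [Finset.sum_sub_distrib]
  rw [h2]
  refine (Finset.abs_sum_le_sum_abs _ _).trans ((Finset.sum_le_sum fun i _ => h1 i).trans ?_)
  simp

theorem measure_gap_gt_le (hf : StableLoss f M γ) (hγ : 0 < γ) {k : ℕ}
    (hk : Fintype.card ι ≤ 2 ^ k) {δ : ℝ} (hδ : 0 < δ) :
    (Measure.pi fun _ : ι => ν) {S | Fintype.card ι * (2 * γ) +
        ∑ i, (∫ S', ∫ z, f (S', z) ∂ν ∂(Measure.pi fun _ => ν) -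
          ∫ S', f (S', S i) ∂(Measure.pi fun _ => ν)) +
        (k + 1) * 2 ^ k * (6 * γ) * Real.log (2 / δ) <
      ∑ i, (∫ z, f (S, z) ∂ν - f (S, S i))} ≤ ENNReal.ofReal δ := by
  have hs : (0 : ℝ) < (k + 1) * 2 ^ k * (6 * γ) := by positivity
  have h := integral_exp_sum_sub_coordAvg_le_two (ν := ν) (by positivity : 0 < 2 * γ)
    (fun i => hf.bdd_resampledGap (ν := ν) i) (fun i => hf.coordAvg_singleton_resampledGap i)
    (fun i => hf.boundedDiff_resampledGap hγ.le i) k Finset.univ (by simpa using hk)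
  have h36 : (3 : ℝ) * (2 * γ) = 6 * γ := by ring
  rw [h36] at h
  have hm := measure_log_div_lt_le (BddMeasurable.div_const (BddMeasurable.sum Finset.univ
    fun i _ => (hf.bdd_resampledGap (ν := ν) i).sub ((hf.bdd_resampledGap i).coordAvg _)) _)
    two_pos hδ h
  refine (measure_mono fun S hS => ?_).trans hm
  simp only [Set.mem_ofPred_eq] at hS ⊢
  rw [lt_div_iff₀ hs]
  have h1 : ∑ i, (∫ z, f (S, z) ∂ν - f (S, S i)) ≤
      ∑ i, (2 * γ + resampledGap ν f i S) := by
    refine Finset.sum_le_sum fun i _ => ?_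
    linarith [(abs_le.1 (hf.abs_gap_sub_resampledGap_le (ν := ν) i S)).2]
  simp only [hf.coordAvg_erase_resampledGap]
  rw [Finset.sum_add_distrib] at h1
  simp only [Finset.sum_const, Finset.card_univ, nsmul_eq_mul] at h1
  rw [Finset.sum_sub_distrib (fun i => resampledGap ν f i S)]
  linarith

theorem integral_averageLoss (hf : StableLoss f M γ) :
    ∫ z, ∫ S, f (S, z) ∂(Measure.pi fun _ : ι => ν) ∂ν =
      ∫ S, ∫ z, f (S, z) ∂ν ∂(Measure.pi fun _ => ν) :=
  (integral_integral_swap (f := fun S z => f (S, z)) (hf.bdd.integrable _)).symm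

theorem measurable_averageLoss (hf : StableLoss f M γ) :
    Measurable (fun z => ∫ S, f (S, z) ∂(Measure.pi fun _ : ι => ν)) :=
  ((hf.bdd.comp measurable_swap).integral_prod_right _).measurable

theorem averageLoss_mem_Icc (hf : StableLoss f M γ) (z : Z) :
    0 ≤ ∫ S, f (S, z) ∂(Measure.pi fun _ : ι => ν) ∧
      ∫ S, f (S, z) ∂(Measure.pi fun _ : ι => ν) ≤ M := by
  refine ⟨integral_nonneg fun S => (hf.mem_Icc _).1, ?_⟩
  refine (integral_mono ((hf.bdd_right _).integrable _)
    (integrable_const M) fun S => (hf.mem_Icc (S, z)).2).trans ?_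
  simp

/-- The population loss of a stable learner exceeds its training loss by little: the leading
term is a fraction `τ` of the expected population loss. -/
theorem measure_popLoss_gt_le (hf : StableLoss f M γ) (hγ : 0 < γ) (hM : 0 < M) {k : ℕ}
    (hk : Fintype.card ι ≤ 2 ^ k) {δ τ : ℝ} (hδ : 0 < δ) (hτ : 0 < τ) (hτ1 : τ ≤ 1) :
    (Measure.pi fun _ : ι => ν) {S | (∑ i, f (S, S i)) + Fintype.card ι * (2 * γ) +
        (Fintype.card ι * (τ * ∫ S', ∫ z, f (S', z) ∂ν ∂(Measure.pi fun _ => ν)) +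
          M / τ * Real.log (1 / δ)) +
        (k + 1) * 2 ^ k * (6 * γ) * Real.log (2 / δ) <
      Fintype.card ι * ∫ z, f (S, z) ∂ν} ≤ ENNReal.ofReal δ + ENNReal.ofReal δ := by
  have h1 := hf.measure_gap_gt_le (ν := ν) hγ hk hδ
  have h2 := measure_chernoff_le (ι := ι) (ν := ν) (hf.measurable_averageLoss (ν := ν))
    -- Multiplied by `M / τ`, the Chernoff bound with this `c` becomes `τ n V + (M / τ) log (1 /
    -- δ)`.
    (hf.averageLoss_mem_Icc (ν := ν)) (c := -(τ / M)) (δ := δ)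
    (by rw [abs_neg, abs_of_pos (by positivity), div_mul_cancel₀ _ hM.ne']; exact hτ1) hδ
  refine le_trans (measure_mono fun S hS => ?_) ((measure_union_le _ _).trans (add_le_add h1 h2))
  by_contra hcon
  rw [Set.mem_union, not_or] at hcon
  obtain ⟨ha, hb⟩ := hcon
  simp only [Set.mem_ofPred_eq, not_lt] at ha hb hS
  rw [hf.integral_averageLoss] at hb
  rw [← Finset.mul_sum] at hb
  simp only [Finset.sum_sub_distrib, Finset.sum_const, Finset.card_univ, nsmul_eq_mul] at ha hb
  have h3 := mul_le_mul_of_nonneg_left hb (by positivity : 0 ≤ M / τ)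
  have e1 : ∀ x : ℝ, M / τ * (-(τ / M) * x) = -x := fun x => by field_simp
  have e2 : ∀ x y : ℝ, M / τ * (x * ((-(τ / M)) ^ 2 * M * y)) = x * (τ * y) := fun x y => by
    field_simp
  rw [e1, mul_add, e2] at h3
  linarith

/-- The training loss of a stable learner exceeds its population loss by little. -/
theorem measure_trainLoss_gt_le (hf : StableLoss f M γ) (hγ : 0 < γ) (hM : 0 < M) {k : ℕ}
    (hk : Fintype.card ι ≤ 2 ^ k) {δ τ : ℝ} (hδ : 0 < δ) (hτ : 0 < τ) (hτ1 : τ ≤ 1) :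
    (Measure.pi fun _ : ι => ν) {S | Fintype.card ι * ∫ z, f (S, z) ∂ν +
        Fintype.card ι * (2 * γ) +
        (Fintype.card ι * (τ * ∫ S', ∫ z, f (S', z) ∂ν ∂(Measure.pi fun _ => ν)) +
          M / τ * Real.log (1 / δ)) +
        (k + 1) * 2 ^ k * (6 * γ) * Real.log (2 / δ) <
      ∑ i, f (S, S i)} ≤ ENNReal.ofReal δ + ENNReal.ofReal δ := by
  have h1 := hf.complement.measure_gap_gt_le (ν := ν) hγ hk hδ
  have h2 := measure_chernoff_le (ι := ι) (ν := ν) (hf.measurable_averageLoss (ν := ν))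
    (hf.averageLoss_mem_Icc (ν := ν)) (c := τ / M) (δ := δ)
    (by rw [abs_of_pos (by positivity), div_mul_cancel₀ _ hM.ne']; exact hτ1) hδ
  refine le_trans (measure_mono fun S hS => ?_) ((measure_union_le _ _).trans (add_le_add h1 h2))
  by_contra hcon
  rw [Set.mem_union, not_or] at hcon
  obtain ⟨ha, hb⟩ := hcon
  simp only [Set.mem_ofPred_eq, not_lt] at ha hb hS
  rw [hf.integral_averageLoss] at hb
  rw [← Finset.mul_sum] at hb
  have i1 : ∀ S : ι → Z, ∫ z, (M - f (S, z)) ∂ν = M - ∫ z, f (S, z) ∂ν := fun S => by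
    rw [integral_sub (integrable_const _)
      ((hf.bdd_left _).integrable _)]
    simp
  have i2 : ∀ z : Z, ∫ S, (M - f (S, z)) ∂(Measure.pi fun _ : ι => ν) =
      M - ∫ S, f (S, z) ∂(Measure.pi fun _ : ι => ν) := fun z => by
    rw [integral_sub (integrable_const _)
      ((hf.bdd_right _).integrable _)]
    simp
  have i3 : ∫ S, (M - ∫ z, f (S, z) ∂ν) ∂(Measure.pi fun _ : ι => ν) =
      M - ∫ S, ∫ z, f (S, z) ∂ν ∂(Measure.pi fun _ : ι => ν) := by
    rw [integral_sub (integrable_const _) (hf.bdd_popLoss.integrable _)]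
    simp
  simp only [i1, i2, i3] at ha
  simp only [Finset.sum_sub_distrib, Finset.sum_const, Finset.card_univ, nsmul_eq_mul] at ha hb
  have h3 := mul_le_mul_of_nonneg_left hb (by positivity : 0 ≤ M / τ)
  have e1 : ∀ x : ℝ, M / τ * (τ / M * x) = x := fun x => by field_simp
  have e2 : ∀ x y : ℝ, M / τ * (x * ((τ / M) ^ 2 * M * y)) = x * (τ * y) := fun x y => by
    field_simp
  rw [e1, mul_add, e2] at h3
  linarith

end StableLoss

end Deviation

/-! ### Best responses in a strongly concave game and the stability they inherit. -/

section MinimaxStability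

variable {E F Z : Type*} [NormedAddCommGroup E] [NormedSpace ℝ E]
  [NormedAddCommGroup F] [NormedSpace ℝ F] [MeasurableSpace Z]

/-- A minimax loss with values in `[0, M]` that is Lipschitz on `Θ × G`, smooth across the two
players, and strongly concave in expectation. -/
structure RegularMinimaxLoss (q : E → F → Z → ℝ) (ν : Measure Z) (Θ : Set E) (G : Set F)
    (M μ L β : ℝ) : Prop where
  isClosed : IsClosed G
  measurable : ∀ θ ∈ Θ, ∀ g ∈ G, Measurable (q θ g)
  mem_Icc : ∀ θ ∈ Θ, ∀ g ∈ G, ∀ z, 0 ≤ q θ g z ∧ q θ g z ≤ M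
  lipschitz : ∀ θ₁ ∈ Θ, ∀ θ₂ ∈ Θ, ∀ g₁ ∈ G, ∀ g₂ ∈ G, ∀ z,
    |q θ₁ g₁ z - q θ₂ g₂ z| ≤ L * ‖θ₁ - θ₂‖ + L * ‖g₁ - g₂‖
  smooth : ∀ θ₁ ∈ Θ, ∀ θ₂ ∈ Θ, ∀ g₁ ∈ G, ∀ g₂ ∈ G, ∀ z,
    |(q θ₁ g₁ z - q θ₂ g₁ z) - (q θ₁ g₂ z - q θ₂ g₂ z)| ≤ β * ‖θ₁ - θ₂‖ * ‖g₁ - g₂‖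
  concave : ∀ θ ∈ Θ, StrongConcaveOn G μ (fun g => ∫ z, q θ g z ∂ν)
  mu_pos : 0 < μ
  L_pos : 0 < L
  beta_pos : 0 < β

namespace RegularMinimaxLoss

variable {q : E → F → Z → ℝ} {ν : Measure Z} [IsProbabilityMeasure ν] {Θ : Set E} {G : Set F}
  {M μ L β : ℝ}

theorem bdd (hq : RegularMinimaxLoss q ν Θ G M μ L β) {θ : E} (hθ : θ ∈ Θ) {g : F} (hg : g ∈ G) :
    BddMeasurable (q θ g) := .of_mem_Icc (hq.measurable θ hθ g hg) (hq.mem_Icc θ hθ g hg)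

theorem risk_mem_Icc (hq : RegularMinimaxLoss q ν Θ G M μ L β) {θ : E} (hθ : θ ∈ Θ) {g : F}
    (hg : g ∈ G) : 0 ≤ ∫ z, q θ g z ∂ν ∧ ∫ z, q θ g z ∂ν ≤ M := by
  refine ⟨integral_nonneg fun z => (hq.mem_Icc θ hθ g hg z).1, ?_⟩
  refine (integral_mono ((hq.bdd hθ hg).integrable ν) (integrable_const M)
    fun z => (hq.mem_Icc θ hθ g hg z).2).trans ?_
  simp

theorem abs_risk_sub_le (hq : RegularMinimaxLoss q ν Θ G M μ L β) {θ₁ θ₂ : E} (h₁ : θ₁ ∈ Θ)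
    (h₂ : θ₂ ∈ Θ) {g₁ g₂ : F} (hg₁ : g₁ ∈ G) (hg₂ : g₂ ∈ G) :
    |∫ z, q θ₁ g₁ z ∂ν - ∫ z, q θ₂ g₂ z ∂ν| ≤ L * ‖θ₁ - θ₂‖ + L * ‖g₁ - g₂‖ := by
  rw [← integral_sub ((hq.bdd h₁ hg₁).integrable ν) ((hq.bdd h₂ hg₂).integrable ν)]
  exact abs_integral_le_of_abs_le (hq.lipschitz _ h₁ _ h₂ _ hg₁ _ hg₂)

/-- At a midpoint, strong concavity gains `μ / 8 · ‖g₁ - g₂‖²`, which cannot exceed the range `M` of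
the risk. -/
theorem isBounded_dual (hq : RegularMinimaxLoss q ν Θ G M μ L β) (hΘ : Θ.Nonempty) :
    Bornology.IsBounded G := by
  obtain ⟨θ, hθ⟩ := hΘ
  have hμ := hq.mu_pos
  refine Metric.isBounded_iff.2 ⟨Real.sqrt (8 * M / μ), fun g₁ hg₁ g₂ hg₂ => ?_⟩
  have h := (hq.concave θ hθ).2 hg₁ hg₂ (by norm_num : (0 : ℝ) ≤ 1 / 2)
    (by norm_num : (0 : ℝ) ≤ 1 / 2) (by norm_num)
  have hmid := (hq.risk_mem_Icc hθ ((hq.concave θ hθ).1 hg₁ hg₂ (by norm_num : (0 : ℝ) ≤ 1 / 2)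
    (by norm_num : (0 : ℝ) ≤ 1 / 2) (by norm_num))).2
  have p₁ := (hq.risk_mem_Icc hθ hg₁).1
  have p₂ := (hq.risk_mem_Icc hθ hg₂).1
  simp only [smul_eq_mul] at h
  rw [dist_eq_norm]
  refine Real.le_sqrt_of_sq_le ?_
  rw [le_div_iff₀ hμ]
  nlinarith

theorem exists_isMaxOn_risk [FiniteDimensional ℝ F] (hq : RegularMinimaxLoss q ν Θ G M μ L β)
    (hG : G.Nonempty) {θ : E} (hθ : θ ∈ Θ) :
    ∃ g ∈ G, IsMaxOn (fun g => ∫ z, q θ g z ∂ν) G g := by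
  have : ProperSpace F := FiniteDimensional.proper ℝ F
  refine (Metric.isCompact_of_isClosed_isBounded hq.isClosed
    (hq.isBounded_dual ⟨θ, hθ⟩)).exists_isMaxOn hG ?_
  have : LipschitzOnWith (Real.toNNReal L) (fun g => ∫ z, q θ g z ∂ν) G := by
    refine LipschitzOnWith.of_dist_le_mul fun g₁ hg₁ g₂ hg₂ => ?_
    have := hq.abs_risk_sub_le hθ hθ hg₁ hg₂
    rw [Real.coe_toNNReal _ hq.L_pos.le, Real.dist_eq, dist_eq_norm]
    simpa using this
  exact this.continuousOn

/-- `gs` selects a best response of the maximizing player. -/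
def IsBestResponse (q : E → F → Z → ℝ) (ν : Measure Z) (Θ : Set E) (G : Set F) (gs : E → F) :
    Prop :=
  ∀ θ ∈ Θ, gs θ ∈ G ∧ ∀ g ∈ G, ∫ z, q θ g z ∂ν ≤ ∫ z, q θ (gs θ) z ∂ν

theorem exists_isBestResponse [FiniteDimensional ℝ F] (hq : RegularMinimaxLoss q ν Θ G M μ L β)
    (hG : G.Nonempty) : ∃ gs, IsBestResponse q ν Θ G gs := by
  have h : ∀ θ, ∃ g, θ ∈ Θ → g ∈ G ∧ ∀ g' ∈ G, ∫ z, q θ g' z ∂ν ≤ ∫ z, q θ g z ∂ν := by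
    intro θ
    by_cases hθ : θ ∈ Θ
    · obtain ⟨g, hg, hmax⟩ := hq.exists_isMaxOn_risk hG hθ
      exact ⟨g, fun _ => ⟨hg, fun g' hg' => hmax hg'⟩⟩
    -- Outside `Θ` the value is arbitrary.
    · exact ⟨0, fun h => absurd h hθ⟩
  choose gs hgs using h
  exact ⟨gs, hgs⟩

variable {gs : E → F}

theorem mul_sq_norm_le_risk_sub (hq : RegularMinimaxLoss q ν Θ G M μ L β)
    (hgs : IsBestResponse q ν Θ G gs) {θ : E} (hθ : θ ∈ Θ) {g : F} (hg : g ∈ G) :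
    μ / 4 * ‖gs θ - g‖ ^ 2 ≤ ∫ z, q θ (gs θ) z ∂ν - ∫ z, q θ g z ∂ν := by
  obtain ⟨hs, hmax⟩ := hgs θ hθ
  have h := (hq.concave θ hθ).2 hs hg (by norm_num : (0 : ℝ) ≤ 1 / 2)
    (by norm_num : (0 : ℝ) ≤ 1 / 2) (by norm_num)
  have hmid := hmax _ ((hq.concave θ hθ).1 hs hg (by norm_num : (0 : ℝ) ≤ 1 / 2)
    (by norm_num : (0 : ℝ) ≤ 1 / 2) (by norm_num))
  simp only [smul_eq_mul] at h
  linarith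

/-- Adding the quadratic growth inequalities at `θ₁` and `θ₂` leaves a mixed second difference of
the risk, which smoothness bounds by `β ‖θ₁ - θ₂‖ ‖gs θ₁ - gs θ₂‖`. -/
theorem norm_bestResponse_sub_le (hq : RegularMinimaxLoss q ν Θ G M μ L β)
    (hgs : IsBestResponse q ν Θ G gs) {θ₁ θ₂ : E} (h₁ : θ₁ ∈ Θ) (h₂ : θ₂ ∈ Θ) :
    ‖gs θ₁ - gs θ₂‖ ≤ 2 * (β / μ) * ‖θ₁ - θ₂‖ := by
  have hμ := hq.mu_pos
  obtain ⟨m₁, -⟩ := hgs θ₁ h₁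
  obtain ⟨m₂, -⟩ := hgs θ₂ h₂
  have a₁ := hq.mul_sq_norm_le_risk_sub hgs h₁ m₂
  have a₂ := hq.mul_sq_norm_le_risk_sub hgs h₂ m₁
  rw [norm_sub_rev] at a₂
  have hmix : |(∫ z, q θ₁ (gs θ₁) z ∂ν - ∫ z, q θ₂ (gs θ₁) z ∂ν) -
      (∫ z, q θ₁ (gs θ₂) z ∂ν - ∫ z, q θ₂ (gs θ₂) z ∂ν)| ≤
      β * ‖θ₁ - θ₂‖ * ‖gs θ₁ - gs θ₂‖ := by
    have b₁₁ := (hq.bdd h₁ m₁).integrable ν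
    have b₁₂ := (hq.bdd h₁ m₂).integrable ν
    have b₂₁ := (hq.bdd h₂ m₁).integrable ν
    have b₂₂ := (hq.bdd h₂ m₂).integrable ν
    rw [← integral_sub b₁₁ b₂₁, ← integral_sub b₁₂ b₂₂]
    erw [← integral_sub (b₁₁.sub b₂₁) (b₁₂.sub b₂₂)]
    exact abs_integral_le_of_abs_le (hq.smooth _ h₁ _ h₂ _ m₁ _ m₂)
  have hle := (abs_le.1 hmix).2
  have hkey : μ * ‖gs θ₁ - gs θ₂‖ ^ 2 ≤ 2 * β * ‖θ₁ - θ₂‖ * ‖gs θ₁ - gs θ₂‖ := by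
    linarith
  rcases (norm_nonneg (gs θ₁ - gs θ₂)).eq_or_lt with h0 | h0
  · rw [← h0]
    have := hq.beta_pos
    positivity
  · have : μ * ‖gs θ₁ - gs θ₂‖ ≤ 2 * β * ‖θ₁ - θ₂‖ := by
      refine le_of_mul_le_mul_right ?_ h0
      linarith
    calc ‖gs θ₁ - gs θ₂‖ ≤ 2 * β * ‖θ₁ - θ₂‖ / μ := (le_div_iff₀' hμ).2 this
      _ = 2 * (β / μ) * ‖θ₁ - θ₂‖ := by ring

theorem continuousOn_bestResponse (hq : RegularMinimaxLoss q ν Θ G M μ L β)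
    (hgs : IsBestResponse q ν Θ G gs) : ContinuousOn gs Θ := by
  have hμ := hq.mu_pos
  have hβ := hq.beta_pos
  have : LipschitzOnWith (Real.toNNReal (2 * (β / μ))) gs Θ := by
    refine LipschitzOnWith.of_dist_le_mul fun θ₁ h₁ θ₂ h₂ => ?_
    rw [Real.coe_toNNReal _ (by positivity), dist_eq_norm, dist_eq_norm]
    exact hq.norm_bestResponse_sub_le hgs h₁ h₂
  exact this.continuousOn

section Measurability

variable [FiniteDimensional ℝ E] [FiniteDimensional ℝ F] [MeasurableSpace E] [BorelSpace E]
  [MeasurableSpace F] [BorelSpace F] {α : Type*} [MeasurableSpace α]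

/-- Carathéodory's criterion: the loss is continuous in the parameters and measurable in the sample.
-/
theorem measurable_comp (hq : RegularMinimaxLoss q ν Θ G M μ L β) {a : α → E} {b : α → F}
    (ha : Measurable a) (hb : Measurable b) (haΘ : ∀ x, a x ∈ Θ) (hbG : ∀ x, b x ∈ G) :
    Measurable (fun p : α × Z => q (a p.1) (b p.1) p.2) := by
  have : ProperSpace E := FiniteDimensional.proper ℝ E
  have : ProperSpace F := FiniteDimensional.proper ℝ F
  have hL := hq.L_pos
  have hu : Measurable (Function.uncurry fun (i : Θ × G) (z : Z) => q i.1 i.2 z) := by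
    refine measurable_uncurry_of_continuous_of_measurable (fun z => ?_)
      fun i => hq.measurable _ i.1.2 _ i.2.2
    have : LipschitzWith (Real.toNNReal (2 * L)) (fun i : Θ × G => q i.1 i.2 z) := by
      refine LipschitzWith.of_dist_le_mul fun i j => ?_
      rw [Real.coe_toNNReal _ (by positivity), Real.dist_eq]
      refine (hq.lipschitz _ i.1.2 _ j.1.2 _ i.2.2 _ j.2.2 z).trans ?_
      have d₁ : ‖(i.1 : E) - j.1‖ ≤ dist i j := by
        rw [← dist_eq_norm, ← Subtype.dist_eq, Prod.dist_eq]; exact le_max_left _ _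
      have d₂ : ‖(i.2 : F) - j.2‖ ≤ dist i j := by
        rw [← dist_eq_norm, ← Subtype.dist_eq, Prod.dist_eq]; exact le_max_right _ _
      nlinarith
    exact this.continuous
  exact hu.comp (((ha.subtype_mk (h := haΘ)).prodMk (hb.subtype_mk (h := hbG))).comp measurable_fst
    |>.prodMk measurable_snd)

theorem measurable_bestResponse_comp (hq : RegularMinimaxLoss q ν Θ G M μ L β)
    (hgs : IsBestResponse q ν Θ G gs) {a : α → E} (ha : Measurable a) (haΘ : ∀ x, a x ∈ Θ) :
    Measurable (fun x => gs (a x)) :=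
  (hq.continuousOn_bestResponse hgs).domRestrict.measurable.comp (ha.subtype_mk (h := haΘ))

end Measurability

section Learner

variable {ι : Type*} [Fintype ι] [DecidableEq ι]
  [FiniteDimensional ℝ E] [FiniteDimensional ℝ F] [MeasurableSpace E] [BorelSpace E]
  [MeasurableSpace F] [BorelSpace F] {a : (ι → Z) → E} {b : (ι → Z) → F} {ε : ℝ}

theorem stableLoss_bestResponse (hq : RegularMinimaxLoss q ν Θ G M μ L β)
    (hgs : IsBestResponse q ν Θ G gs) (ha : Measurable a) (haΘ : ∀ S, a S ∈ Θ)
    (hstab : ∀ S i z, ‖a (Function.update S i z) - a S‖ ≤ ε) {γ : ℝ}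
    (hγ : (2 * (β / μ) + 1) * L * ε ≤ γ) :
    StableLoss (fun p : (ι → Z) × Z => q (a p.1) (gs (a p.1)) p.2) M γ where
  measurable := hq.measurable_comp ha (hq.measurable_bestResponse_comp hgs ha haΘ) haΘ
    fun S => (hgs _ (haΘ S)).1
  mem_Icc p := hq.mem_Icc _ (haΘ _) _ (hgs _ (haΘ _)).1 _
  stable S i z' z := by
    have hL := hq.L_pos
    have hβμ : 0 < β / μ := div_pos hq.beta_pos hq.mu_pos
    refine (hq.lipschitz _ (haΘ _) _ (haΘ _) _ (hgs _ (haΘ _)).1 _ (hgs _ (haΘ _)).1 z).trans ?_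
    have h1 := hstab S i z'
    have h2 := hq.norm_bestResponse_sub_le hgs (haΘ (Function.update S i z')) (haΘ S)
    have h3 : 2 * (β / μ) * ‖a (Function.update S i z') - a S‖ ≤ 2 * (β / μ) * ε := by gcongr
    have h4 := mul_le_mul_of_nonneg_left (h2.trans h3) hL.le
    have h5 := mul_le_mul_of_nonneg_left h1 hL.le
    linarith

theorem stableLoss_const (hq : RegularMinimaxLoss q ν Θ G M μ L β) {θ₀ : E} (hθ₀ : θ₀ ∈ Θ)
    (hb : Measurable b) (hbG : ∀ S, b S ∈ G)
    (hstab : ∀ S i z, ‖b (Function.update S i z) - b S‖ ≤ ε) {γ : ℝ} (hγ : L * ε ≤ γ) :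
    StableLoss (fun p : (ι → Z) × Z => q θ₀ (b p.1) p.2) M γ where
  measurable := hq.measurable_comp (a := fun _ => θ₀) measurable_const hb (fun _ => hθ₀) hbG
  mem_Icc p := hq.mem_Icc _ hθ₀ _ (hbG _) _
  stable S i z' z := by
    have hL := hq.L_pos
    refine (hq.lipschitz _ hθ₀ _ hθ₀ _ (hbG _) _ (hbG _) z).trans ?_
    have h5 := mul_le_mul_of_nonneg_left (hstab S i z') hL.le
    simp only [sub_self, norm_zero, mul_zero, zero_add]
    linarith

/-- The primal risk of a stable approximate saddle point exceeds a multiple of the primal risk of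
any competitor `θ₀` by little. The numerical terms are still those of the dyadic argument. -/
theorem measure_primal_gt_le (hq : RegularMinimaxLoss q ν Θ G M μ L β)
    (hgs : IsBestResponse q ν Θ G gs) (ha : Measurable a) (haΘ : ∀ S, a S ∈ Θ)
    (hb : Measurable b) (hbG : ∀ S, b S ∈ G)
    (hastab : ∀ S i z, ‖a (Function.update S i z) - a S‖ ≤ ε)
    (hbstab : ∀ S i z, ‖b (Function.update S i z) - b S‖ ≤ ε) {e : ℝ}
    (hsaddle : ∀ᵐ S ∂(Measure.pi fun _ : ι => ν), ∀ θ ∈ Θ, ∀ g ∈ G,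
      ∑ i, q (a S) g (S i) ≤ (∑ i, q θ (b S) (S i)) + Fintype.card ι * e)
    {θ₀ : E} (hθ₀ : θ₀ ∈ Θ) (hn : 0 < Fintype.card ι) {k : ℕ} (hk : Fintype.card ι ≤ 2 ^ k)
    (hM : 0 < M) {γ τ δ : ℝ} (hγ : 0 < γ) (hγ₁ : (2 * (β / μ) + 1) * L * ε ≤ γ)
    (hγ₂ : L * ε ≤ γ) (hδ : 0 < δ) (hτ : 0 < τ) (hτ1 : τ ≤ 1) :
    (Measure.pi fun _ : ι => ν) {S |
        Fintype.card ι * ((1 + 2 * τ) * (∫ z, q θ₀ (gs θ₀) z ∂ν) + (1 + τ) * e +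
          (4 + 4 * τ) * γ) + 2 * (M / τ * Real.log (1 / δ)) +
          2 * ((k + 1) * 2 ^ k * (6 * γ) * Real.log (2 / δ)) <
        Fintype.card ι * ∫ z, q (a S) (gs (a S)) z ∂ν} ≤
      ENNReal.ofReal δ + ENNReal.ofReal δ + (ENNReal.ofReal δ + ENNReal.ofReal δ) := by
  have f₁ := hq.stableLoss_bestResponse hgs ha haΘ hastab hγ₁
  have f₂ := hq.stableLoss_const hθ₀ hb hbG hbstab hγ₂
  have m₁ := f₁.measure_popLoss_gt_le (ν := ν) hγ hM hk hδ hτ hτ1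
  have m₂ := f₂.measure_trainLoss_gt_le (ν := ν) hγ hM hk hδ hτ hτ1
  have i₁ := f₁.abs_integral_gap_le (ν := ν)
  have i₂ := f₂.abs_integral_gap_le (ν := ν)
  simp only at m₁ m₂ i₁ i₂
  set n : ℝ := ((Fintype.card ι : ℕ) : ℝ) with hn'
  have hn0 : 0 < n := by rw [hn']; exact_mod_cast hn
  set R₁ := ∫ S, ∫ z, q (a S) (gs (a S)) z ∂ν ∂(Measure.pi fun _ : ι => ν) with hR₁
  set R₂ := ∫ S, ∫ z, q θ₀ (b S) z ∂ν ∂(Measure.pi fun _ : ι => ν) with hR₂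
  set Q₀ := ∫ z, q θ₀ (gs θ₀) z ∂ν with hQ₀
  have hpop₂ : ∀ S, ∫ z, q θ₀ (b S) z ∂ν ≤ Q₀ := fun S => (hgs θ₀ hθ₀).2 _ (hbG S)
  have hR₂Q : R₂ ≤ Q₀ := by
    refine (integral_mono (f₂.bdd_popLoss.integrable _) (integrable_const Q₀) hpop₂).trans ?_
    simp
  have hsad : ∀ᵐ S ∂(Measure.pi fun _ : ι => ν), ∑ i, q (a S) (gs (a S)) (S i) ≤
      (∑ i, q θ₀ (b S) (S i)) + n * e := by
    filter_upwards [hsaddle] with S hS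
    exact hS θ₀ hθ₀ _ (hgs _ (haΘ S)).1
  have hI : ∫ S, ∑ i, q (a S) (gs (a S)) (S i) ∂(Measure.pi fun _ : ι => ν) ≤
      ∫ S, ∑ i, q θ₀ (b S) (S i) ∂(Measure.pi fun _ : ι => ν) + n * e := by
    have b₂ := (BddMeasurable.sum Finset.univ fun i _ => f₂.bdd_eval i).integrable
      (Measure.pi fun _ : ι => ν)
    have := integral_mono_ae ((BddMeasurable.sum Finset.univ fun i _ => f₁.bdd_eval i).integrable
      (Measure.pi fun _ : ι => ν)) (b₂.add (integrable_const (n * e))) hsad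
    refine this.trans (le_of_eq ?_)
    rw [integral_add' b₂ (integrable_const _)]
    simp
  -- The saddle inequality in expectation, with a gap of `2γ` for each of the two losses.
  have hR₁Q : n * R₁ ≤ n * (Q₀ + 4 * γ + e) := by
    have := (abs_le.1 i₁).2
    have := (abs_le.1 i₂).1
    have := mul_le_mul_of_nonneg_left hR₂Q hn0.le
    linarith
  refine le_trans (measure_mono_ae ?_) ((measure_union_le _ _).trans (add_le_add m₁ m₂))
  filter_upwards [hsad] with S c₃ hS
  by_contra hcon
  obtain ⟨c₁, c₂⟩ := not_or.1 hcon
  change _ < _ at hS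
  simp only [Set.mem_ofPred_eq, not_lt] at c₁ c₂
  -- The Chernoff terms `τ R₁` and `τ R₂` give `2 τ Q₀`, `τ e` and `4 τ γ`; the two resampling
  -- errors give the other `4γ`.
  have t₁ := mul_le_mul_of_nonneg_left hR₁Q hτ.le
  have t₂ := mul_le_mul_of_nonneg_left (mul_le_mul_of_nonneg_left hR₂Q hn0.le) hτ.le
  have t₃ := mul_le_mul_of_nonneg_left (hpop₂ S) hn0.le
  linarith

end Learner

end RegularMinimaxLoss

end MinimaxStability

/-! ### Numerical simplification of the bound. -/

section Rates

theorem half_le_log_one_div {δ : ℝ} (hδ : 0 < δ) (hδ2 : δ ≤ 1 / 2) :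
    Real.log 2 ≤ Real.log (1 / δ) ∧ 1 / 2 ≤ Real.log (1 / δ) := by
  have h : Real.log 2 ≤ Real.log (1 / δ) := by
    refine Real.log_le_log two_pos ?_
    rw [le_div_iff₀ hδ]
    linarith
  exact ⟨h, by linarith [Real.log_two_gt_d9]⟩

theorem log_two_pow_div_le {δ : ℝ} (hδ : 0 < δ) (hδ2 : δ ≤ 1 / 2) (j : ℕ) :
    Real.log (2 ^ j / δ) ≤ (j + 1) * Real.log (1 / δ) := by
  have h := (half_le_log_one_div hδ hδ2).1
  rw [div_eq_mul_one_div, Real.log_mul (by positivity) (by positivity), Real.log_pow]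
  nlinarith [mul_le_mul_of_nonneg_left h (Nat.cast_nonneg (α := ℝ) j)]

theorem clog_add_one_mul_two_pow_le {n : ℕ} (hn : 2 ≤ n) :
    ((Nat.clog 2 n : ℝ) + 1) * 2 ^ Nat.clog 2 n ≤ 6 * n * Real.logb 2 n := by
  obtain ⟨k, hk⟩ : ∃ k, Nat.clog 2 n = k + 1 :=
    Nat.exists_eq_succ_of_ne_zero (Nat.clog_pos one_lt_two hn).ne'
  have h1 : 2 ^ k < n := by
    have := Nat.pow_pred_clog_lt_self one_lt_two (x := n) (by omega)
    simpa [hk] using this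
  have h1' : (2 : ℝ) ^ k ≤ n := by exact_mod_cast h1.le
  have hn0 : (0 : ℝ) < n := by positivity
  have h2 : (k : ℝ) ≤ Real.logb 2 n := by
    rw [Real.le_logb_iff_rpow_le one_lt_two hn0, Real.rpow_natCast]
    exact h1'
  have h3 : 1 ≤ Real.logb 2 n := by
    rw [Real.le_logb_iff_rpow_le one_lt_two hn0, Real.rpow_one]
    exact_mod_cast hn
  rw [hk]
  push_cast
  calc ((k : ℝ) + 1 + 1) * 2 ^ (k + 1) ≤ (3 * Real.logb 2 n) * (2 * n) := by
        rw [pow_succ']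
        gcongr
        linarith
    _ = 6 * n * Real.logb 2 n := by ring

/-- Here `lam` stands for `log₂ n`, `l` for `log (1 / δ)`, and `P` for the dyadic factor. The choice
of `τ` gives `2 τ ≤ η` and `1 / τ = 2 (1 + η) / η`; since `lam ≤ n`, the summand `M / n ^ 2` of `γ`
contributes only order `M / n · l`. -/
theorem stability_rate_le {n lam l l₁ l₂ P η τ B M e Q₀ γ : ℝ} (hn : 0 < n) (hlam : 1 ≤ lam)
    (hlamn : lam ≤ n) (hl : 1 / 2 ≤ l) (hl₁ : l₁ ≤ 3 * l) (hl₂ : l₂ ≤ 4 * l) (hP0 : 0 ≤ P)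
    (hP : P ≤ 6 * n * lam) (hη : 0 < η) (hτ : τ = η / (2 * (1 + η))) (hB : 0 ≤ B) (hM : 0 ≤ M)
    (he : 0 ≤ e) (hQ₀ : 0 ≤ Q₀) (hγ : γ = 2 * B + M / n ^ 2) :
    n * ((1 + 2 * τ) * Q₀ + (1 + τ) * e + (4 + 4 * τ) * γ) + 2 * (M / τ * l₁) +
        2 * (P * (6 * γ) * l₂) ≤
      n * ((1 + η) * Q₀ + 600 * ((1 + η) / η) * (M / n * l + B * lam * l + e)) := by
  have hl0 : 0 < l := by linarith
  have hlam0 : 0 < lam := by linarith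
  have hγ0 : 0 ≤ γ := by rw [hγ]; positivity
  set K := (1 + η) / η with hK
  have hK1 : 1 ≤ K := by rw [hK, le_div_iff₀ hη]; linarith
  have hτK : M / τ = 2 * K * M := by rw [hτ, hK]; field_simp
  have hτη : 2 * τ ≤ η := by
    have : 2 * τ = η / (1 + η) := by rw [hτ]; field_simp
    rw [this]
    exact div_le_self hη.le (by linarith)
  have hτ2 : τ ≤ 1 / 2 := by
    rw [hτ, div_le_div_iff₀ (by positivity) two_pos]
    linarith
  have hll : 1 / 2 ≤ lam * l := by nlinarith
  have hγl : γ * (lam * l) ≤ 2 * (B * lam * l) + M / n * l := by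
    have h1 : M / n ^ 2 * (lam * l) ≤ M / n ^ 2 * (n * l) := by gcongr
    have h2 : M / n ^ 2 * (n * l) = M / n * l := by field_simp
    rw [hγ]
    nlinarith
  have t₁ : (1 + 2 * τ) * Q₀ ≤ (1 + η) * Q₀ := by gcongr
  have t₂ : (1 + τ) * e ≤ 2 * e := by gcongr; linarith
  have t₃ : (4 + 4 * τ) * γ ≤ 12 * (γ * (lam * l)) := by
    have : (4 + 4 * τ) * γ ≤ 6 * γ := by gcongr; linarith
    nlinarith [mul_le_mul_of_nonneg_left hll hγ0]
  have t₄ : 2 * (M / τ * l₁) ≤ n * (12 * K * (M / n * l)) := by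
    have h1 : n * (12 * K * (M / n * l)) = 2 * (2 * K * M * (3 * l)) := by field_simp; ring
    rw [hτK, h1]
    gcongr
  have t₅ : 2 * (P * (6 * γ) * l₂) ≤ n * (288 * (γ * (lam * l))) := by
    have h1 : P * (6 * γ) * l₂ ≤ (6 * n * lam) * (6 * γ) * (4 * l) := by
      calc P * (6 * γ) * l₂ ≤ P * (6 * γ) * (4 * l) := by gcongr
        _ ≤ (6 * n * lam) * (6 * γ) * (4 * l) := by gcongr
    linarith
  set X := M / n * l with hX
  set Y := B * lam * l with hY
  have hX0 : 0 ≤ X := by rw [hX]; positivity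
  have hY0 : 0 ≤ Y := by rw [hY]; positivity
  have t₆ : (1 + 2 * τ) * Q₀ + (1 + τ) * e + (4 + 4 * τ) * γ + 12 * K * X +
      288 * (γ * (lam * l)) ≤ (1 + η) * Q₀ + 600 * K * (X + Y + e) := by
    have a₁ : X ≤ K * X := le_mul_of_one_le_left hX0 hK1
    have a₂ : Y ≤ K * Y := le_mul_of_one_le_left hY0 hK1
    have a₃ : e ≤ K * e := le_mul_of_one_le_left he hK1
    have : 600 * K * (X + Y + e) = 600 * (K * X) + 600 * (K * Y) + 600 * (K * e) := by ring
    rw [this]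
    linarith
  have := mul_le_mul_of_nonneg_left t₆ hn.le
  linarith

end Rates

/-! ### The explicit rate for a fixed seed. -/

namespace RegularMinimaxLoss

variable {E F Z : Type*} [NormedAddCommGroup E] [NormedSpace ℝ E]
  [NormedAddCommGroup F] [NormedSpace ℝ F] [MeasurableSpace Z]
  {q : E → F → Z → ℝ} {ν : Measure Z} [IsProbabilityMeasure ν] {Θ : Set E} {G : Set F}
  {M μ L β : ℝ} {gs : E → F}
  {ι : Type*} [Fintype ι] [DecidableEq ι]
  [FiniteDimensional ℝ E] [FiniteDimensional ℝ F] [MeasurableSpace E] [BorelSpace E]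
  [MeasurableSpace F] [BorelSpace F] {a : (ι → Z) → E} {b : (ι → Z) → F} {ε : ℝ}

/-- The primal risk of a stable approximate saddle point is, with high probability, at most
`1 + η` times the primal risk of any competitor, up to a term of order `1 / n`. -/
theorem measure_primal_gt_rate_le (hq : RegularMinimaxLoss q ν Θ G M μ L β)
    (hgs : IsBestResponse q ν Θ G gs) (ha : Measurable a) (haΘ : ∀ S, a S ∈ Θ)
    (hb : Measurable b) (hbG : ∀ S, b S ∈ G) (hε : 0 ≤ ε)
    (hastab : ∀ S i z, ‖a (Function.update S i z) - a S‖ ≤ ε)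
    (hbstab : ∀ S i z, ‖b (Function.update S i z) - b S‖ ≤ ε) {e : ℝ} (he : 0 ≤ e)
    (hsaddle : ∀ᵐ S ∂(Measure.pi fun _ : ι => ν), ∀ θ ∈ Θ, ∀ g ∈ G,
      ∑ i, q (a S) g (S i) ≤ (∑ i, q θ (b S) (S i)) + Fintype.card ι * e)
    {θ₀ : E} (hθ₀ : θ₀ ∈ Θ) {n : ℕ} (hcard : Fintype.card ι = n) (hn : 2 ≤ n)
    (hM : 0 < M) {η δ : ℝ} (hη : 0 < η) (hδ : 0 < δ) (hδ2 : δ ≤ 1 / 2) :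
    (Measure.pi fun _ : ι => ν) {S | (1 + η) * (∫ z, q θ₀ (gs θ₀) z ∂ν) +
        600 * ((1 + η) / η) * (M / n * Real.log (1 / δ) +
          (β / μ + 1) * L * ε * Real.logb 2 n * Real.log (1 / δ) + e) <
        ∫ z, q (a S) (gs (a S)) z ∂ν} ≤ ENNReal.ofReal δ := by
  have hL := hq.L_pos
  have hβμ : 0 < β / μ := div_pos hq.beta_pos hq.mu_pos
  have hn0 : (0 : ℝ) < n := by positivity
  have hlam : 1 ≤ Real.logb 2 n := by
    rw [Real.le_logb_iff_rpow_le one_lt_two hn0, Real.rpow_one]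
    exact_mod_cast hn
  have hlamn : Real.logb 2 n ≤ n := by
    rw [Real.logb_le_iff_le_rpow one_lt_two hn0, Real.rpow_natCast]
    exact_mod_cast n.lt_two_pow_self.le
  have hLε : 0 ≤ L * ε := by positivity
  have hM2 : 0 < M / (n : ℝ) ^ 2 := by positivity
  have hrate := stability_rate_le (Q₀ := ∫ z, q θ₀ (gs θ₀) z ∂ν) (e := e)
    (B := (β / μ + 1) * L * ε) (M := M) (η := η) hn0 hlam hlamn
    (half_le_log_one_div hδ hδ2).2 (by
      have := log_two_pow_div_le hδ hδ2 2
      norm_num at this ⊢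
      exact this)
    (by
      have := log_two_pow_div_le hδ hδ2 3
      norm_num at this ⊢
      exact this) (by positivity)
    (clog_add_one_mul_two_pow_le hn) hη rfl (by positivity) hM.le he
    (hq.risk_mem_Icc hθ₀ (hgs θ₀ hθ₀).1).1 rfl
  have hτ1 : η / (2 * (1 + η)) ≤ 1 := by
    rw [div_le_one (by positivity)]
    linarith
  have h := hq.measure_primal_gt_le hgs ha haΘ hb hbG hastab hbstab hsaddle hθ₀
    (k := Nat.clog 2 n) (by omega) (hcard ▸ Nat.le_pow_clog one_lt_two n) hM
    -- The summand `M / n ^ 2` keeps `γ` positive even when `ε = 0`. The four exceptional events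
    -- receive probability `δ / 4` each.
    (γ := 2 * ((β / μ + 1) * L * ε) + M / (n : ℝ) ^ 2) (by positivity)
    (by nlinarith) (by nlinarith [mul_nonneg hβμ.le hLε]) (δ := δ / 4) (by positivity)
    (τ := η / (2 * (1 + η))) (by positivity) hτ1
  rw [hcard] at h
  refine (measure_mono fun S hS => ?_).trans (h.trans (le_of_eq ?_))
  · rw [Set.mem_ofPred_eq] at hS ⊢
    have e₁ : (1 : ℝ) / (δ / 4) = 4 / δ := by field_simp
    have e₂ : (2 : ℝ) / (δ / 4) = 8 / δ := by field_simp; norm_num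
    rw [e₁, e₂]
    exact hrate.trans_lt (mul_lt_mul_of_pos_left hS hn0)
  · have h4 : (0 : ℝ) ≤ δ / 4 := by positivity
    rw [← ENNReal.ofReal_add h4 h4, ← ENNReal.ofReal_add (by positivity) (by positivity)]
    congr 1
    ring

end RegularMinimaxLoss

/-! ### Continuous invariance learning as a regular minimax loss. -/

namespace CILModel

variable {X Y R O : Type*} [MeasurableSpace X] [MeasurableSpace Y] {k a b c d : ℕ}
  {T : Set (EuclideanSpace ℝ (Fin k))} {m : CILModel X Y R O k a b c d}
  {ν : Measure (Sample X Y T)} {Θ : Set (PrimalParam a b c)} {G : Set (DualParam d)}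
  {M μ L β : ℝ}

theorem norm_gradient_eq_norm_fderiv {E : Type*} [NormedAddCommGroup E] [InnerProductSpace ℝ E]
    [CompleteSpace E] (f : E → ℝ) (x : E) : ‖gradient f x‖ = ‖fderiv ℝ f x‖ := by
  rw [gradient, LinearIsometryEquiv.norm_map]

theorem regularMinimaxLoss (hμ : 0 < μ) (hL : 0 < L) (hβ : 0 < β) (hΘ : Convex ℝ Θ)
    (hGc : IsClosed G) (hG : Convex ℝ G)
    (hmeas : ∀ θ ∈ Θ, ∀ g ∈ G, Measurable (fun z : Sample X Y T => m.q θ g z))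
    (hbd : ∀ θ ∈ Θ, ∀ g ∈ G, ∀ z : Sample X Y T, 0 ≤ m.q θ g z ∧ m.q θ g z ≤ M)
    (hconc : ∀ θ ∈ Θ, StrongConcaveOn G μ (fun g => m.risk ν θ g))
    (hdiff : m.IsDifferentiable T Θ G) (hgrad : m.HasBoundedGradient T Θ G L)
    (hsmooth : m.IsSmooth T Θ G β) :
    RegularMinimaxLoss (m.q : _ → _ → Sample X Y T → ℝ) ν Θ G M μ L β where
  isClosed := hGc
  measurable := hmeas
  mem_Icc := hbd
  lipschitz θ₁ h₁ θ₂ h₂ g₁ hg₁ g₂ hg₂ z := by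
    have e₁ : ‖m.q θ₁ g₁ z - m.q θ₂ g₁ z‖ ≤ L * ‖θ₁ - θ₂‖ :=
      hΘ.norm_image_sub_le_of_norm_fderiv_le (𝕜 := ℝ) (f := fun θ => m.q θ g₁ z)
        (fun θ hθ => (hdiff θ hθ g₁ hg₁ z).1)
        (fun θ hθ => by
          rw [← norm_gradient_eq_norm_fderiv]; exact (hgrad θ hθ g₁ hg₁ z).1) h₂ h₁
    have e₂ : ‖m.q θ₂ g₁ z - m.q θ₂ g₂ z‖ ≤ L * ‖g₁ - g₂‖ :=
      hG.norm_image_sub_le_of_norm_fderiv_le (𝕜 := ℝ) (f := fun g => m.q θ₂ g z)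
        (fun g hg => (hdiff θ₂ h₂ g hg z).2)
        (fun g hg => by
          rw [← norm_gradient_eq_norm_fderiv]; exact (hgrad θ₂ h₂ g hg z).2) hg₂ hg₁
    calc |m.q θ₁ g₁ z - m.q θ₂ g₂ z|
        = |(m.q θ₁ g₁ z - m.q θ₂ g₁ z) + (m.q θ₂ g₁ z - m.q θ₂ g₂ z)| := by congr 1; ring
      _ ≤ _ := (abs_add_le _ _).trans (add_le_add e₁ e₂)
  smooth θ₁ h₁ θ₂ h₂ g₁ hg₁ g₂ hg₂ z := by
    -- Mean value inequality in `g` for the difference of the losses at `θ₁` and `θ₂`; its gradient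
    -- is bounded by smoothness at two points with the same `g`.
    refine hG.norm_image_sub_le_of_norm_fderiv_le (𝕜 := ℝ)
      (f := fun g => m.q θ₁ g z - m.q θ₂ g z)
      (fun g hg => (hdiff θ₁ h₁ g hg z).2.sub (hdiff θ₂ h₂ g hg z).2) (fun g hg => ?_) hg₂ hg₁
    have hsub : fderiv ℝ (fun g => m.q θ₁ g z - m.q θ₂ g z) g =
        fderiv ℝ (fun g => m.q θ₁ g z) g - fderiv ℝ (fun g => m.q θ₂ g z) g :=
      fderiv_fun_sub (hdiff θ₁ h₁ g hg z).2 (hdiff θ₂ h₂ g hg z).2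
    have hnorm : ‖fderiv ℝ (fun g => m.q θ₁ g z) g - fderiv ℝ (fun g => m.q θ₂ g z) g‖ =
        ‖m.gradDual θ₁ g z - m.gradDual θ₂ g z‖ := by
      simp only [gradDual, gradient]
      rw [← map_sub, LinearIsometryEquiv.norm_map]
    rw [hsub, hnorm]
    have h := hsmooth θ₁ h₁ θ₂ h₂ g hg g hg z
    rw [sub_self, WithLp.norm_toLp_fst] at h
    exact (WithLp.norm_snd_le (x := WithLp.toLp 2 (m.gradPrimal θ₁ g z - m.gradPrimal θ₂ g z,
      m.gradDual θ₁ g z - m.gradDual θ₂ g z))).trans h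
  concave := hconc
  mu_pos := hμ
  L_pos := hL
  beta_pos := hβ

theorem primalRisk_eq [IsProbabilityMeasure ν]
    {gs : PrimalParam a b c → DualParam d}
    (hgs : RegularMinimaxLoss.IsBestResponse (m.q : _ → _ → Sample X Y T → ℝ) ν Θ G gs)
    {θ : PrimalParam a b c} (hθ : θ ∈ Θ) :
    m.primalRisk ν G θ = ∫ z, m.q θ (gs θ) z ∂ν := by
  obtain ⟨hs, hmax⟩ := hgs θ hθ
  have : Nonempty G := ⟨⟨_, hs⟩⟩
  refine le_antisymm (ciSup_le fun g => hmax g g.2) ?_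
  exact le_ciSup (f := fun g : G => m.risk ν θ g)
    ⟨∫ z, m.q θ (gs θ) z ∂ν, by rintro _ ⟨g, rfl⟩; exact hmax g g.2⟩ ⟨_, hs⟩

theorem IsApproxSaddle.sum_le {n : ℕ} {S : Fin n → Sample X Y T} (hn : 0 < n)
    {ε₁ ε₂ : ℝ} {θ₀ : PrimalParam a b c} {g₀ : DualParam d}
    (hbd : ∀ θ ∈ Θ, ∀ g ∈ G, ∀ z : Sample X Y T, 0 ≤ m.q θ g z ∧ m.q θ g z ≤ M)
    (h : m.IsApproxSaddle Θ G S ε₁ ε₂ θ₀ g₀) {θ : PrimalParam a b c} (hθ : θ ∈ Θ)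
    {g : DualParam d} (hg : g ∈ G) :
    ∑ i, m.q θ₀ g (S i) ≤ (∑ i, m.q θ g₀ (S i)) + n * (ε₁ + ε₂) := by
  have hn0 : (0 : ℝ) < n := by exact_mod_cast hn
  have hlow : BddBelow (Set.range fun θ : Θ => m.empRisk S θ g₀) := by
    refine ⟨0, ?_⟩
    rintro _ ⟨θ, rfl⟩
    exact mul_nonneg (by positivity)
      (Finset.sum_nonneg fun i _ => (hbd θ θ.2 g₀ h.mem_dual (S i)).1)
  have hup : BddAbove (Set.range fun g : G => m.empRisk S θ₀ g) := by
    refine ⟨1 / (n : ℝ) * ∑ _i : Fin n, M, ?_⟩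
    rintro _ ⟨g, rfl⟩
    exact mul_le_mul_of_nonneg_left
      (Finset.sum_le_sum fun i _ => (hbd θ₀ h.mem_primal g g.2 (S i)).2) (by positivity)
  have h₁ := ciInf_le hlow ⟨θ, hθ⟩
  have h₂ := le_ciSup hup ⟨g, hg⟩
  have h₃ : m.empRisk S θ₀ g ≤ m.empRisk S θ g₀ + (ε₁ + ε₂) := by
    have := h.le_inf
    have := h.sup_le
    simp only at h₁ h₂
    linarith
  have h₄ := mul_le_mul_of_nonneg_left h₃ hn0.le
  simp only [empRisk] at h₄
  rw [mul_add, ← mul_assoc, ← mul_assoc, mul_one_div_cancel hn0.ne', one_mul, one_mul] at h₄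
  exact h₄

end CILModel

/-! ### The final bound: choice of a competitor and integration over the seed. -/

theorem proposition2 :
    -- an absolute constant
    ∃ C : ℝ, 0 < C ∧
    ∀ {X Y R O Ω : Type*} [MeasurableSpace X] [MeasurableSpace Y] [MeasurableSpace Ω]
      {k a b c d n : ℕ} (T : Set (EuclideanSpace ℝ (Fin k)))
      (m : CILModel X Y R O k a b c d)
      -- the distribution of a sample
      (ν : Measure (Sample X Y T)) [IsProbabilityMeasure ν]
      -- the internal randomness of the algorithm
      (P : Measure Ω) [IsProbabilityMeasure P]
      (Θ : Set (PrimalParam a b c)) (G : Set (DualParam d))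
      -- the training algorithm, for instance stochastic gradient descent ascent, where `ω : Ω` holds
      -- the initialization and the mini-batches
      (A : Ω → (Fin n → Sample X Y T) → PrimalParam a b c × DualParam d)
      (M μ L β ε ε₁ ε₂ η δ : ℝ),
      0 < n → 0 < μ → 0 < L → 0 < β → 0 < η → 0 < δ → δ ≤ 1 / 2 →
      IsClosed Θ → Convex ℝ Θ → IsClosed G → Convex ℝ G →
      -- the loss is measurable in the sample and takes values in `[0, M]`
      (∀ θ ∈ Θ, ∀ g ∈ G, Measurable (fun z : Sample X Y T => m.q θ g z)) →
      (∀ θ ∈ Θ, ∀ g ∈ G, ∀ z : Sample X Y T, 0 ≤ m.q θ g z ∧ m.q θ g z ≤ M) →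
      -- strong convexity and strong concavity of the population objective
      (∀ g ∈ G, StrongConvexOn Θ μ (fun θ => m.risk ν θ g)) →
      (∀ θ ∈ Θ, StrongConcaveOn G μ (fun g => m.risk ν θ g)) →
      -- Lipschitz continuity and smoothness of the loss
      m.IsDifferentiable T Θ G → m.HasBoundedGradient T Θ G L → m.IsSmooth T Θ G β →
      -- the algorithm is argument-stable and returns an approximate saddle point
      Measurable (fun p : Ω × (Fin n → Sample X Y T) => A p.1 p.2) →
      (∀ ω S, (A ω S).1 ∈ Θ ∧ (A ω S).2 ∈ G) →
      (∀ᵐ ω ∂P, ArgumentStable (A ω) ε) →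
      (∀ᵐ p ∂(P.prod (Measure.pi fun _ : Fin n => ν)),
        m.IsApproxSaddle Θ G p.2 ε₁ ε₂ (A p.1 p.2).1 (A p.1 p.2).2) →
      ENNReal.ofReal (1 - δ) ≤ (P.prod (Measure.pi fun _ : Fin n => ν))
        {p | m.primalRisk ν G (A p.1 p.2).1 ≤
          (1 + η) * (⨅ θ : Θ, m.primalRisk ν G θ) +
            C * ((1 + η) / η) * (M / n * Real.log (1 / δ) +
              (β / μ + 1) * L * ε * Real.logb 2 n * Real.log (1 / δ) + ε₁ + ε₂)} := by
  -- The rate for a fixed competitor has 600; one more unit pays for a competitor that only nearly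
  -- attains the infimum.
  refine ⟨601, by norm_num, ?_⟩
  intro X Y R O Ω _ _ _ k a b c d n T m ν _ P _ Θ G A M μ L β ε ε₁ ε₂ η δ hn hμ hL hβ hη hδ hδ2
    _ hΘ hGc hG hmeas hbd _ hconc hdiff hgrad hsmooth hA hmem hstab hsad
  have hq := CILModel.regularMinimaxLoss hμ hL hβ hΘ hGc hG hmeas hbd hconc hdiff hgrad hsmooth
  have hn0 : (0 : ℝ) < n := by exact_mod_cast hn
  obtain ⟨⟨ω₀, S₀⟩, hp₀⟩ := hsad.exists
  have hG0 : G.Nonempty := ⟨_, hp₀.mem_dual⟩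
  have hz₀ : Nonempty (Sample X Y T) := ⟨S₀ ⟨0, hn⟩⟩
  have hM0 : 0 ≤ M := by
    have := hbd _ hp₀.mem_primal _ hp₀.mem_dual (S₀ ⟨0, hn⟩)
    linarith
  have he : 0 ≤ ε₁ + ε₂ := by
    have := hp₀.sum_le hn hbd hp₀.mem_primal hp₀.mem_dual
    have h' : 0 ≤ n * (ε₁ + ε₂) := by linarith
    exact nonneg_of_mul_nonneg_right h' hn0
  have hε : 0 ≤ ε := by
    obtain ⟨ω, hω⟩ := hstab.exists
    exact (norm_nonneg _).trans (hω S₀ ⟨0, hn⟩ (S₀ ⟨0, hn⟩)).1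
  obtain ⟨gs, hgs⟩ := hq.exists_isBestResponse hG0
  have hl := (half_le_log_one_div hδ hδ2).2
  have hK : 1 ≤ (1 + η) / η := by rw [le_div_iff₀ hη]; linarith
  have hlam : 0 ≤ Real.logb 2 n :=
    Real.logb_nonneg one_lt_two (by exact_mod_cast hn)
  have hprim : ∀ θ ∈ Θ, 0 ≤ m.primalRisk ν G θ ∧ m.primalRisk ν G θ ≤ M := fun θ hθ => by
    rw [CILModel.primalRisk_eq hgs hθ]
    exact hq.risk_mem_Icc hθ (hgs θ hθ).1
  have hinf : 0 ≤ ⨅ θ : Θ, m.primalRisk ν G θ := Real.iInf_nonneg fun θ => (hprim θ θ.2).1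
  set I := ⨅ θ : Θ, m.primalRisk ν G θ with hI
  set l := Real.log (1 / δ) with hl'
  set K := (1 + η) / η with hK'
  set W := (β / μ + 1) * L * ε * Real.logb 2 n * l with hW
  have hl0 : 0 < l := by linarith
  have hW0 : 0 ≤ W := by rw [hW]; positivity
  -- For `n = 1` the factor `log₂ n` vanishes, but `M / n · l` already dominates the trivial bound
  -- `Q* ≤ M`.
  by_cases htriv : n = 1 ∨ M = 0
  · have huniv : {p : Ω × (Fin n → Sample X Y T) | m.primalRisk ν G (A p.1 p.2).1 ≤
        (1 + η) * I + 601 * K * (M / n * l + W + ε₁ + ε₂)} = Set.univ := by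
      refine Set.eq_univ_of_forall fun p => ?_
      rw [Set.mem_ofPred_eq]
      refine (hprim _ (hmem p.1 p.2).1).2.trans ?_
      have h1 : M ≤ 601 * K * (M / n * l) := by
        rcases htriv with h | h
        · rw [h, Nat.cast_one, div_one]
          have : 1 * (1 / 2) ≤ K * l := by gcongr
          nlinarith
        · simp [h]
      have h2 : 0 ≤ 601 * K * (W + (ε₁ + ε₂)) := by positivity
      have h3 : 0 ≤ (1 + η) * I := by positivity
      linarith
    rw [huniv, measure_univ]
    exact ENNReal.ofReal_le_one.2 (by linarith)
  · rw [not_or] at htriv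
    have hn2 : 2 ≤ n := by omega
    have hM : 0 < M := lt_of_le_of_ne hM0 (Ne.symm htriv.2)
    -- Multiplied by `1 + η`, this slack becomes exactly `K * (M / n * l)`.
    obtain ⟨⟨θ₀, hθ₀⟩, hθ₀I⟩ : ∃ θ : Θ, m.primalRisk ν G θ < I + 1 / η * (M / n * l) := by
      have : Nonempty Θ := ⟨⟨_, hp₀.mem_primal⟩⟩
      exact exists_lt_of_ciInf_lt (lt_add_of_pos_right _ (by positivity))
    simp only at hθ₀I
    rw [CILModel.primalRisk_eq hgs hθ₀] at hθ₀I
    have hA₁ : Measurable (fun p : Ω × (Fin n → Sample X Y T) => (A p.1 p.2).1) := hA.fst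
    have hmsel := (BddMeasurable.integral_prod_right (BddMeasurable.of_mem_Icc
      (hq.measurable_comp hA₁ (hq.measurable_bestResponse_comp hgs hA₁ fun p => (hmem p.1 p.2).1)
        (fun p => (hmem p.1 p.2).1) fun p => (hgs _ (hmem p.1 p.2).1).1)
      fun p => hq.mem_Icc _ (hmem _ _).1 _ (hgs _ (hmem _ _).1).1 _) ν).measurable
    set t := (1 + η) * (∫ z, m.q θ₀ (gs θ₀) z ∂ν) + 600 * K * (M / n * l + W + (ε₁ + ε₂)) with ht
    -- Written with `gs` instead of a supremum over `G`, the event is measurable because `gs` is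
    -- continuous on `Θ`; Tonelli then reduces its probability to a fixed seed.
    set bad := {p : Ω × (Fin n → Sample X Y T) |
      t < ∫ z, m.q (A p.1 p.2).1 (gs (A p.1 p.2).1) z ∂ν} with hbad
    have hbadm : MeasurableSet bad := measurableSet_lt measurable_const hmsel
    have hbadle : (P.prod (Measure.pi fun _ : Fin n => ν)) bad ≤ ENNReal.ofReal δ := by
      rw [Measure.prod_apply hbadm]
      calc _ ≤ ∫⁻ _, ENNReal.ofReal δ ∂P := by
            refine lintegral_mono_ae ?_
            filter_upwards [hstab, Measure.ae_ae_of_ae_prod hsad] with ω hω hωS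
            exact hq.measure_primal_gt_rate_le hgs (a := fun S => (A ω S).1)
              (b := fun S => (A ω S).2) (hA.comp measurable_prodMk_left).fst
              (fun S => (hmem ω S).1) (hA.comp measurable_prodMk_left).snd
              (fun S => (hmem ω S).2) hε (fun S i z => (hω S i z).1) (fun S i z => (hω S i z).2)
              he (by
                filter_upwards [hωS] with S hS θ hθ g hg
                rw [Fintype.card_fin]
                exact hS.sum_le hn hbd hθ hg) hθ₀ (Fintype.card_fin n) hn2 hM hη hδ hδ2
        _ = ENNReal.ofReal δ := by simp
    have hsub : badᶜ ⊆ {p : Ω × (Fin n → Sample X Y T) | m.primalRisk ν G (A p.1 p.2).1 ≤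
        (1 + η) * I + 601 * K * (M / n * l + W + ε₁ + ε₂)} := by
      intro p hp
      have hp' : ∫ z, m.q (A p.1 p.2).1 (gs (A p.1 p.2).1) z ∂ν ≤ t := not_lt.1 hp
      rw [Set.mem_ofPred_eq]
      rw [CILModel.primalRisk_eq hgs (hmem p.1 p.2).1]
      refine hp'.trans ?_
      have h1 := mul_le_mul_of_nonneg_left hθ₀I.le (by positivity : 0 ≤ 1 + η)
      have h2 : (1 + η) * (I + 1 / η * (M / n * l)) = (1 + η) * I + K * (M / n * l) := by
        rw [hK']; ring
      have h3 : 0 ≤ K * (W + (ε₁ + ε₂)) := by positivity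
      rw [h2] at h1
      rw [ht]
      linarith
    refine le_trans ?_ (measure_mono hsub)
    rw [prob_compl_eq_one_sub hbadm, ENNReal.ofReal_sub _ hδ.le, ENNReal.ofReal_one]
    exact tsub_le_tsub_left hbadle _
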